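/- For a finite set $P \subset \mathbb{R}^d$, let the spread $q_d(P)$ be the maximum Euclidean distance between two points of $P$ divided by the minimum distance between two distinct points of $P$ (with $q_d(P) = 0$ by convention if $|P| \le 1$). For an integer $\ell$, say that a set $S \subset \mathbb{R}^d$, not necessarily in general position, is $\ell$-hole-free if for any $\ell$ distinct points $s_1, \dots, s_\ell \in S$ there is a point $s \in S$ in the interior (in $\mathbb{R}^d$) of the convex hull of $\{s_1, \dots, s_\ell\}$. For every integer $d \ge 2$ there exist a real constant $\alpha_d$ and a natural number $C'_d$, both depending only on $d$, such that for every natural number $k$ there is a set $P \subset \mathbb{R}^d$ of exactly $k$ points with $q_d(P) \le \alpha_d k^{1/d}$ which is $C'_d$-hole-free. Moreover, these constants may be chosen so that $C'_d = d^{O(d^3)}$, that is, $C'_d \le d^{A d^3}$ for all $d \ge 2$ with an absolute constant $A$, and so that $C'_2 = 7$. -/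

import Mathlib

/-- A set `S ⊆ ℝ^d` (not necessarily in general position) is `ℓ`-hole-free if, for any `ℓ`
(distinct) points of `S`, some point of `S` lies in the interior (with respect to `ℝ^d`) of the
convex hull of these `ℓ` points. -/
def HoleFree {d : ℕ} (ℓ : ℕ) (S : Set (EuclideanSpace ℝ (Fin d))) : Prop :=
  ∀ A : Finset (EuclideanSpace ℝ (Fin d)), (A : Set (EuclideanSpace ℝ (Fin d))) ⊆ S →
    A.card = ℓ → ∃ s ∈ S, s ∈ interior (convexHull ℝ (A : Set (EuclideanSpace ℝ (Fin d))))

/-- The spread of a finite set `P ⊆ ℝ^d`: the maximum distance between two points of `P`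
(`Metric.diam`) divided by the minimum distance between two distinct points of `P`
(`Set.infsep`). If `P` has at most one point, then both numbers are `0` and the spread is `0`. -/
noncomputable def pointSpread {d : ℕ} (P : Finset (EuclideanSpace ℝ (Fin d))) : ℝ :=
  Metric.diam (P : Set (EuclideanSpace ℝ (Fin d))) /
    Set.infsep (P : Set (EuclideanSpace ℝ (Fin d)))

/-- A dual criterion for a point to be in the interior of the convex hull of a finite set. -/
theorem mem_interior_convexHull_of_forall_inner {d : ℕ} (hd : 0 < d)
    {A : Set (EuclideanSpace ℝ (Fin d))} {p : EuclideanSpace ℝ (Fin d)}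
    (h : ∀ w : EuclideanSpace ℝ (Fin d), w ≠ 0 → ∃ a ∈ A, 0 < inner ℝ w (a - p)) :
    p ∈ interior (convexHull ℝ A) := by
  have hfun : ∀ f : StrongDual ℝ (EuclideanSpace ℝ (Fin d)), f ≠ 0 → ∃ a ∈ A, f p < f a := by
    intro f hf
    obtain ⟨w, rfl⟩ := (InnerProductSpace.toDual ℝ (EuclideanSpace ℝ (Fin d))).surjective f
    have hw : w ≠ 0 := by rintro rfl; simp at hf
    obtain ⟨a, ha, hlt⟩ := h w hw
    refine ⟨a, ha, ?_⟩
    rw [inner_sub_right] at hlt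
    simpa using hlt
  by_contra hp
  by_cases hne : (interior (convexHull ℝ A)).Nonempty
  · obtain ⟨f, hf⟩ := geometric_hahn_banach_open_point
      (convex_convexHull ℝ A).interior isOpen_interior hp
    have hf0 : f ≠ 0 := by
      rintro rfl
      obtain ⟨x, hx⟩ := hne
      simpa using hf x hx
    obtain ⟨a, ha, hlt⟩ := hfun f hf0
    have hcl : a ∈ closure (interior (convexHull ℝ A)) := by
      rw [(convex_convexHull ℝ A).closure_interior_eq_closure_of_nonempty_interior hne]
      exact subset_closure (subset_convexHull ℝ A ha)
    have : f a ≤ f p :=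
      closure_minimal (fun x hx => (hf x hx).le) (isClosed_le f.continuous continuous_const) hcl
    linarith
  · rw [interior_convexHull_nonempty_iff_affineSpan_eq_top] at hne
    have hx0 : ∃ w : EuclideanSpace ℝ (Fin d), w ≠ 0 := by
      refine ⟨EuclideanSpace.single ⟨0, hd⟩ 1, ?_⟩
      simp
    obtain ⟨w0, hw0⟩ := hx0
    obtain ⟨a0, ha0, -⟩ := h w0 hw0
    have hdir : vectorSpan ℝ A ≠ ⊤ := by
      intro htop
      exact hne ((AffineSubspace.affineSpan_eq_top_iff_vectorSpan_eq_top_of_nonempty _ _ _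
        ⟨a0, ha0⟩).2 htop)
    have horth : (vectorSpan ℝ A)ᗮ ≠ ⊥ := by
      intro hb
      exact hdir ((Submodule.orthogonal_eq_bot_iff).1 hb)
    obtain ⟨w, hw, hw0⟩ := Submodule.exists_mem_ne_zero_of_ne_bot horth
    obtain ⟨a, ha, h1⟩ := h w hw0
    obtain ⟨b, hb, h2⟩ := h (-w) (neg_ne_zero.2 hw0)
    have h3 : inner ℝ w (a - b) = 0 := by
      rw [real_inner_comm]
      exact Submodule.inner_right_of_mem_orthogonal (vsub_mem_vectorSpan ℝ ha hb) hw
    have h4 : a - b = (a - p) - (b - p) := by abel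
    rw [h4, inner_sub_right] at h3
    rw [inner_neg_left] at h2
    linarith

/-- Removing a point of maximal norm preserves `HoleFree`. -/
theorem HoleFree.erase_max {d ℓ : ℕ} (hd : 0 < d) {Q : Finset (EuclideanSpace ℝ (Fin d))}
    (h : HoleFree ℓ (Q : Set (EuclideanSpace ℝ (Fin d))))
    {q : EuclideanSpace ℝ (Fin d)} (hq : ∀ x ∈ Q, ‖x‖ ≤ ‖q‖)
    [DecidableEq (EuclideanSpace ℝ (Fin d))] :
    HoleFree ℓ (Q.erase q : Set (EuclideanSpace ℝ (Fin d))) := by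
  intro A hA hcard
  have hAQ : ∀ x ∈ A, x ∈ Q := fun x hx => Finset.mem_of_mem_erase (hA hx)
  obtain ⟨s, hs, hi⟩ := h A (fun x hx => hAQ x hx) hcard
  refine ⟨s, ?_, hi⟩
  rw [Finset.mem_coe, Finset.mem_erase]
  refine ⟨?_, hs⟩
  rintro rfl
  have : Nontrivial (EuclideanSpace ℝ (Fin d)) := by
    refine ⟨⟨EuclideanSpace.single ⟨0, hd⟩ 1, 0, ?_⟩⟩
    simp
  have hsub : convexHull ℝ (A : Set (EuclideanSpace ℝ (Fin d))) ⊆ Metric.closedBall 0 ‖s‖ :=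
    convexHull_min (fun x hx => by simpa using hq x (hAQ x hx)) (convex_closedBall _ _)
  have hmem := interior_mono hsub hi
  rw [interior_closedBall'] at hmem
  simp at hmem

theorem HoleFree.exists_subset_card {d ℓ k : ℕ} (hd : 0 < d)
    {Q : Finset (EuclideanSpace ℝ (Fin d))}
    (h : HoleFree ℓ (Q : Set (EuclideanSpace ℝ (Fin d)))) (hk : k ≤ Q.card) :
    ∃ P ⊆ Q, P.card = k ∧ HoleFree ℓ (P : Set (EuclideanSpace ℝ (Fin d))) := by
  classical
  induction hn : Q.card - k generalizing Q with
  | zero => exact ⟨Q, subset_rfl, by omega, h⟩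
  | succ n ih =>
    have hne : Q.Nonempty := by rw [← Finset.card_pos]; omega
    obtain ⟨q, hqQ, hq⟩ := Q.exists_max_image (fun x => ‖x‖) hne
    have hc := Finset.card_erase_of_mem hqQ
    obtain ⟨P, hP, h1, h2⟩ := ih (h.erase_max hd hq) (by omega) (by omega)
    exact ⟨P, hP.trans (Finset.erase_subset _ _), h1, h2⟩

/-- The lattice points of the cube `[0, n) ^ d`. -/
noncomputable def latticeCube (d n : ℕ) : Finset (Fin d → ℤ) := Fintype.piFinset fun _ => Finset.Ico 0 (n : ℤ)

theorem mem_latticeCube {d n : ℕ} {x : Fin d → ℤ} :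
    x ∈ latticeCube d n ↔ ∀ i, 0 ≤ x i ∧ x i < n := by
  simp [latticeCube]

theorem card_latticeCube (d n : ℕ) : (latticeCube d n).card = n ^ d := by
  simp [latticeCube]

theorem half_le_dist_of_near_lattice {d : ℕ} {Φ : (Fin d → ℤ) → EuclideanSpace ℝ (Fin d)}
    (hΦ : ∀ x i, |Φ x i - x i| ≤ 1 / 4) {x y : Fin d → ℤ} (hxy : x ≠ y) :
    1 / 2 ≤ dist (Φ x) (Φ y) := by
  obtain ⟨i, hi⟩ := Function.ne_iff.1 hxy
  have h1 : ‖(Φ x - Φ y) i‖ ≤ ‖Φ x - Φ y‖ := PiLp.norm_apply_le _ i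
  rw [dist_eq_norm]
  refine le_trans ?_ h1
  rw [PiLp.sub_apply, Real.norm_eq_abs]
  have h2 : (1 : ℝ) ≤ |(x i : ℝ) - y i| := by
    have : 1 ≤ |x i - y i| := Int.one_le_abs (sub_ne_zero.2 hi)
    exact_mod_cast this
  have h3 := hΦ x i
  have h4 := hΦ y i
  rw [abs_le] at h3 h4
  rcases le_abs'.1 h2 with h | h
  · rw [le_abs']; left; linarith
  · rw [le_abs']; right; linarith

theorem injective_of_near_lattice {d : ℕ} {Φ : (Fin d → ℤ) → EuclideanSpace ℝ (Fin d)}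
    (hΦ : ∀ x i, |Φ x i - x i| ≤ 1 / 4) : Function.Injective Φ := by
  intro x y h
  by_contra hne
  have := half_le_dist_of_near_lattice hΦ hne
  rw [h, dist_self] at this
  norm_num at this

theorem dist_le_of_near_lattice {d n : ℕ} {Φ : (Fin d → ℤ) → EuclideanSpace ℝ (Fin d)}
    (hΦ : ∀ x i, |Φ x i - x i| ≤ 1 / 4) {x y : Fin d → ℤ} (hx : x ∈ latticeCube d n)
    (hy : y ∈ latticeCube d n) : dist (Φ x) (Φ y) ≤ d * n := by
  rw [EuclideanSpace.dist_eq]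
  have hcoord : ∀ i, dist (Φ x i) (Φ y i) ≤ n := by
    intro i
    have h3 := hΦ x i
    have h4 := hΦ y i
    have hx' := mem_latticeCube.1 hx i
    have hy' := mem_latticeCube.1 hy i
    have a1 : (x i : ℝ) + 1 ≤ n := by exact_mod_cast hx'.2
    have a2 : (y i : ℝ) + 1 ≤ n := by exact_mod_cast hy'.2
    have a3 : (0 : ℝ) ≤ x i := by exact_mod_cast hx'.1
    have a4 : (0 : ℝ) ≤ y i := by exact_mod_cast hy'.1
    rw [abs_le] at h3 h4
    rw [Real.dist_eq, abs_le]
    constructor <;> linarith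
  calc √(∑ i, dist (Φ x i) (Φ y i) ^ 2) ≤ √(∑ _i : Fin d, (n : ℝ) ^ 2) := by
        apply Real.sqrt_le_sqrt
        exact Finset.sum_le_sum fun i _ => pow_le_pow_left₀ dist_nonneg (hcoord i) 2
    _ ≤ d * n := by
        rw [Real.sqrt_le_iff]
        refine ⟨by positivity, ?_⟩
        simp only [Finset.sum_const, Finset.card_univ, Fintype.card_fin, nsmul_eq_mul]
        rw [mul_pow]
        gcongr
        rcases Nat.eq_zero_or_pos d with rfl | h
        · simp
        · have : (1 : ℝ) ≤ d := by exact_mod_cast h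
          nlinarith

theorem pointSpread_eq_zero_of_subsingleton {d : ℕ} {P : Finset (EuclideanSpace ℝ (Fin d))}
    (h : P.card ≤ 1) : pointSpread P = 0 := by
  have : (P : Set (EuclideanSpace ℝ (Fin d))).Subsingleton := by
    intro x hx y hy
    exact Finset.card_le_one.1 h x hx y hy
  rw [pointSpread, Metric.diam_subsingleton this, zero_div]

theorem pointSpread_le {d : ℕ} {P : Finset (EuclideanSpace ℝ (Fin d))} {D : ℝ} (hD : 0 ≤ D)
    (h1 : ∀ x ∈ P, ∀ y ∈ P, dist x y ≤ D)
    (h2 : ∀ x ∈ P, ∀ y ∈ P, x ≠ y → 1 / 2 ≤ dist x y) : pointSpread P ≤ 2 * D := by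
  by_cases hc : P.card ≤ 1
  · rw [pointSpread_eq_zero_of_subsingleton hc]; positivity
  have hnt : (P : Set (EuclideanSpace ℝ (Fin d))).Nontrivial := by
    obtain ⟨x, hx, y, hy, hxy⟩ := Finset.one_lt_card.1 (not_le.1 hc)
    exact ⟨x, hx, y, hy, hxy⟩
  have hsep : 1 / 2 ≤ Set.infsep (P : Set (EuclideanSpace ℝ (Fin d))) :=
    hnt.le_infsep (fun x hx y hy hxy => h2 x hx y hy hxy)
  have hdiam : Metric.diam (P : Set (EuclideanSpace ℝ (Fin d))) ≤ D :=
    Metric.diam_le_of_forall_dist_le hD (fun x hx y hy => h1 x hx y hy)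
  rw [pointSpread, div_le_iff₀ (by linarith)]
  nlinarith

/-- Perturbed lattice cubes without holes give sets of every size with small spread. -/
theorem exists_holeFree_of_perturbation {d ℓ : ℕ} (hd : 0 < d)
    (h : ∀ n : ℕ, ∃ Φ : (Fin d → ℤ) → EuclideanSpace ℝ (Fin d),
      (∀ x i, |Φ x i - x i| ≤ 1 / 4) ∧ HoleFree ℓ (Φ '' (latticeCube d n))) (k : ℕ) :
    ∃ P : Finset (EuclideanSpace ℝ (Fin d)), P.card = k ∧
      pointSpread P ≤ (4 * d) * (k : ℝ) ^ (1 / (d : ℝ)) ∧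
      HoleFree ℓ (P : Set (EuclideanSpace ℝ (Fin d))) := by
  classical
  set r : ℝ := (k : ℝ) ^ (1 / (d : ℝ)) with hr
  have hr0 : 0 ≤ r := by positivity
  obtain ⟨Φ, hΦ, hole⟩ := h ⌈r⌉₊
  have hcard : k ≤ ((latticeCube d ⌈r⌉₊).image Φ).card := by
    rw [Finset.card_image_of_injective _ (injective_of_near_lattice hΦ), card_latticeCube]
    have h1 : r ≤ ⌈r⌉₊ := Nat.le_ceil r
    have h2 : (k : ℝ) = r ^ d := by
      rw [hr, ← Real.rpow_natCast, ← Real.rpow_mul (by positivity), one_div,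
        inv_mul_cancel₀ (by positivity), Real.rpow_one]
    have h3 : (k : ℝ) ≤ (⌈r⌉₊ : ℝ) ^ d := by
      rw [h2]; exact pow_le_pow_left₀ hr0 h1 d
    exact_mod_cast h3
  obtain ⟨P, hPQ, hPk, hP⟩ := HoleFree.exists_subset_card (ℓ := ℓ) hd
    (Q := (latticeCube d ⌈r⌉₊).image Φ) (by rw [Finset.coe_image]; exact hole) hcard
  refine ⟨P, hPk, ?_, hP⟩
  rcases Nat.eq_zero_or_pos k with rfl | hk
  · rw [pointSpread_eq_zero_of_subsingleton (by omega)]; positivity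
  have hk1 : (1 : ℝ) ≤ k := by exact_mod_cast hk
  have hr1 : 1 ≤ r := Real.one_le_rpow hk1 (by positivity)
  have hceil : (⌈r⌉₊ : ℝ) ≤ 2 * r := by
    have := (Nat.ceil_lt_add_one hr0).le
    linarith
  have hmem : ∀ x ∈ P, ∃ a ∈ latticeCube d ⌈r⌉₊, Φ a = x := fun x hx =>
    Finset.mem_image.1 (hPQ hx)
  have := pointSpread_le (P := P) (D := d * ⌈r⌉₊) (by positivity) ?_ ?_
  · refine this.trans ?_
    have hd0 : (0 : ℝ) ≤ d := by positivity
    nlinarith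
  · intro x hx y hy
    obtain ⟨a, ha, rfl⟩ := hmem x hx
    obtain ⟨b, hb, rfl⟩ := hmem y hy
    exact dist_le_of_near_lattice hΦ ha hb
  · intro x hx y hy hxy
    obtain ⟨a, ha, rfl⟩ := hmem x hx
    obtain ⟨b, hb, rfl⟩ := hmem y hy
    exact half_le_dist_of_near_lattice hΦ (fun hab => hxy (by rw [hab]))

/-- To show that a perturbed lattice cube is hole-free it suffices to look at lattice points. -/
theorem holeFree_image_latticeCube {d n ℓ : ℕ} {Φ : (Fin d → ℤ) → EuclideanSpace ℝ (Fin d)}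
    (hd : 0 < d) (hΦ : ∀ x i, |Φ x i - x i| ≤ 1 / 4)
    (h : ∀ A ⊆ latticeCube d n, A.card = ℓ → ∃ p ∈ latticeCube d n,
      ∀ w : EuclideanSpace ℝ (Fin d), w ≠ 0 → ∃ a ∈ A, 0 < inner ℝ w (Φ a - Φ p)) :
    HoleFree ℓ (Φ '' (latticeCube d n)) := by
  classical
  intro B hB hcard
  obtain ⟨A, hA, rfl⟩ := Finset.subset_set_image_iff.1 hB
  rw [Finset.card_image_of_injective _ (injective_of_near_lattice hΦ)] at hcard
  obtain ⟨p, hp, hw⟩ := h A (by exact_mod_cast hA) hcard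
  refine ⟨Φ p, ⟨p, hp, rfl⟩, mem_interior_convexHull_of_forall_inner hd fun w hw0 => ?_⟩
  obtain ⟨a, ha, h0⟩ := hw w hw0
  exact ⟨Φ a, by simpa using ⟨a, ha, rfl⟩, h0⟩

/-- Coordinatewise congruence of lattice points. -/
def LatticeCong {d : ℕ} (N : ℕ) (x y : Fin d → ℤ) : Prop := ∀ i, x i ≡ y i [ZMOD N]

namespace LatticeCong

variable {d : ℕ} {M N : ℕ} {x y z : Fin d → ℤ}

theorem symm (h : LatticeCong N x y) : LatticeCong N y x := fun i => (h i).symm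

theorem trans (h : LatticeCong N x y) (h' : LatticeCong N y z) : LatticeCong N x z :=
  fun i => (h i).trans (h' i)

theorem of_dvd (h : LatticeCong N x y) (hMN : M ∣ N) : LatticeCong M x y :=
  fun i => (h i).of_dvd (Int.natCast_dvd_natCast.2 hMN)

theorem one (x y : Fin d → ℤ) : LatticeCong 1 x y := fun i => by simp [Int.modEq_one]

end LatticeCong

theorem exists_residue_index (d : ℕ) {N : ℕ} (hN : 0 < N) :
    ∃ G : (Fin d → ℤ) → ℕ, (∀ x, G x < N ^ d) ∧ ∀ x y, G x = G y ↔ LatticeCong N x y := by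
  have : NeZero N := ⟨hN.ne'⟩
  let e := Fintype.equivFin (Fin d → ZMod N)
  refine ⟨fun x => e fun i => (x i : ZMod N), fun x => ?_, fun x y => ?_⟩
  · refine (e _).isLt.trans_eq ?_
    simp [ZMod.card]
  · rw [Fin.val_inj, e.injective.eq_iff, funext_iff]
    exact forall_congr' fun i => ZMod.intCast_eq_intCast_iff _ _ _

/-- A function on the lattice that separates residue classes modulo `q ^ (k + 1)` at scale
`θ ^ k`, for all `k < K`. -/
structure Hierarchical {d : ℕ} (q K : ℕ) (B θ : ℝ) (F : (Fin d → ℤ) → ℝ) : Prop where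
  abs_le : ∀ x, |F x| ≤ B
  abs_sub_le : ∀ k ≤ K, ∀ x y, LatticeCong (q ^ k) x y → |F x - F y| ≤ B * θ ^ k
  le_abs_sub : ∀ k < K, ∀ x y, LatticeCong (q ^ k) x y → ¬ LatticeCong (q ^ (k + 1)) x y →
    θ ^ k / 2 ≤ |F x - F y|

theorem exists_hierarchical (d K : ℕ) {q : ℕ} (hq : 0 < q) :
    ∃ B : ℝ, 1 ≤ B ∧ ∀ θ : ℝ, 0 < θ → 2 * (B * θ) ≤ 1 →
      ∃ F : (Fin d → ℤ) → ℝ, Hierarchical q K B θ F := by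
  choose G hG1 hG2 using fun m : ℕ => exists_residue_index d (N := q ^ (m + 1)) (by positivity)
  let b : ℕ → ℝ := fun m => ((q ^ (m + 1)) ^ d : ℕ)
  have hb0 : ∀ m, 0 ≤ b m := fun m => by positivity
  have hGb : ∀ m x, (G m x : ℝ) ≤ b m := fun m x =>
    Nat.cast_le.2 (hG1 m x).le
  have hGG : ∀ m x y, |(G m x : ℝ) - G m y| ≤ b m := by
    intro m x y
    have h1 := hGb m x
    have h2 := hGb m y
    have h3 : (0 : ℝ) ≤ G m x := by positivity
    have h4 : (0 : ℝ) ≤ G m y := by positivity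
    rw [abs_le]; constructor <;> linarith
  have hS : 0 ≤ ∑ m ∈ Finset.range K, b m := Finset.sum_nonneg fun m _ => hb0 m
  refine ⟨1 + ∑ m ∈ Finset.range K, b m, by linarith, fun θ hθ hBθ => ?_⟩
  set B := 1 + ∑ m ∈ Finset.range K, b m with hB
  have hθ1 : θ ≤ 1 := by nlinarith
  have hdiff : ∀ x y, (∑ m ∈ Finset.range K, θ ^ m * (G m x : ℝ))
      - (∑ m ∈ Finset.range K, θ ^ m * (G m y : ℝ))
      = ∑ m ∈ Finset.range K, θ ^ m * ((G m x : ℝ) - G m y) := by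
    intro x y
    rw [← Finset.sum_sub_distrib]
    exact Finset.sum_congr rfl fun m _ => by ring
  have hzero : ∀ k m x y, m < k → LatticeCong (q ^ k) x y → (G m x : ℝ) - G m y = 0 := by
    intro k m x y hmk hxy
    rw [(hG2 m x y).2 (hxy.of_dvd (pow_dvd_pow q hmk)), sub_self]
  refine ⟨fun x => ∑ m ∈ Finset.range K, θ ^ m * (G m x : ℝ), ?_, ?_, ?_⟩
  · intro x
    rw [abs_of_nonneg (by positivity), hB]
    have : ∑ m ∈ Finset.range K, θ ^ m * (G m x : ℝ) ≤ ∑ m ∈ Finset.range K, b m := by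
      refine Finset.sum_le_sum fun m _ => ?_
      calc θ ^ m * (G m x : ℝ) ≤ 1 * b m :=
            mul_le_mul (pow_le_one₀ hθ.le hθ1) (hGb m x) (by positivity) zero_le_one
        _ = b m := one_mul _
    linarith
  · intro k hk x y hxy
    simp only [hdiff]
    calc |∑ m ∈ Finset.range K, θ ^ m * ((G m x : ℝ) - G m y)|
        ≤ ∑ m ∈ Finset.range K, |θ ^ m * ((G m x : ℝ) - G m y)| := Finset.abs_sum_le_sum_abs _ _
      _ ≤ ∑ m ∈ Finset.range K, θ ^ k * b m := by
          refine Finset.sum_le_sum fun m _ => ?_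
          rcases lt_or_ge m k with h | h
          · rw [hzero k m x y h hxy, mul_zero, abs_zero]
            exact mul_nonneg (by positivity) (hb0 m)
          · rw [abs_mul, abs_of_nonneg (by positivity)]
            exact mul_le_mul (pow_le_pow_of_le_one hθ.le hθ1 h) (hGG m x y) (abs_nonneg _)
              (by positivity)
      _ = (∑ m ∈ Finset.range K, b m) * θ ^ k := by rw [← Finset.mul_sum, mul_comm]
      _ ≤ B * θ ^ k := by
          apply mul_le_mul_of_nonneg_right _ (by positivity)
          linarith
  · intro k hk x y hxy hnxy
    simp only [hdiff]
    rw [← Finset.add_sum_erase _ _ (Finset.mem_range.2 hk)]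
    have h1 : 1 ≤ |(G k x : ℝ) - G k y| := by
      have hne : (G k x : ℤ) - G k y ≠ 0 := by
        rw [sub_ne_zero]
        intro h
        exact hnxy ((hG2 k x y).1 (by exact_mod_cast h))
      exact_mod_cast Int.one_le_abs hne
    have h2 : |∑ m ∈ (Finset.range K).erase k, θ ^ m * ((G m x : ℝ) - G m y)|
        ≤ (B - 1) * θ ^ (k + 1) := by
      calc _ ≤ ∑ m ∈ (Finset.range K).erase k, |θ ^ m * ((G m x : ℝ) - G m y)| :=
            Finset.abs_sum_le_sum_abs _ _
        _ ≤ ∑ m ∈ (Finset.range K).erase k, θ ^ (k + 1) * b m := by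
            refine Finset.sum_le_sum fun m hm => ?_
            rcases lt_or_ge m k with h | h
            · rw [hzero k m x y h hxy, mul_zero, abs_zero]
              exact mul_nonneg (by positivity) (hb0 m)
            · have h' : k + 1 ≤ m := by
                have := Finset.ne_of_mem_erase hm
                omega
              rw [abs_mul, abs_of_nonneg (by positivity)]
              exact mul_le_mul (pow_le_pow_of_le_one hθ.le hθ1 h') (hGG m x y) (abs_nonneg _)
                (by positivity)
        _ ≤ ∑ m ∈ Finset.range K, θ ^ (k + 1) * b m :=
            Finset.sum_le_sum_of_subset_of_nonneg (Finset.erase_subset _ _)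
              fun m _ _ => mul_nonneg (by positivity) (hb0 m)
        _ = (B - 1) * θ ^ (k + 1) := by rw [← Finset.mul_sum, mul_comm, hB]; ring
    have h3 : θ ^ k ≤ |θ ^ k * ((G k x : ℝ) - G k y)| := by
      rw [abs_mul, abs_of_nonneg (by positivity : (0 : ℝ) ≤ θ ^ k)]
      exact le_mul_of_one_le_right (by positivity) h1
    have h4 : (B - 1) * θ ^ (k + 1) ≤ θ ^ k / 2 := by
      rw [pow_succ]
      have : 0 < θ ^ k := by positivity
      nlinarith
    have h5 := abs_sub_abs_le_abs_sub (θ ^ k * ((G k x : ℝ) - G k y))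
      (-∑ m ∈ (Finset.range K).erase k, θ ^ m * ((G m x : ℝ) - G m y))
    rw [abs_neg, sub_neg_eq_add] at h5
    linarith

/-- Pigeonhole principle for residue classes, starting inside one residue class. -/
theorem exists_large_residue_class {d : ℕ} {m N : ℕ} (hm : 0 < m) (hN : 0 < N)
    {A : Finset (Fin d → ℤ)} (hA : ∀ x ∈ A, ∀ y ∈ A, LatticeCong m x y) :
    ∃ A' ⊆ A, A.card ≤ N ^ d * A'.card ∧ (A.Nonempty → A'.Nonempty) ∧
      (∀ x ∈ A', ∀ y ∈ A', LatticeCong (m * N) x y) ∧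
      ∀ x ∈ A, ∀ y ∈ A', LatticeCong (m * N) x y → x ∈ A' := by
  classical
  rcases A.eq_empty_or_nonempty with rfl | ⟨a0, ha0⟩
  · exact ⟨∅, subset_rfl, by simp, fun h => h, by simp, by simp⟩
  obtain ⟨G, hG1, hG2⟩ := exists_residue_index d hN
  have key : ∀ x ∈ A, ∀ y ∈ A, (G (fun i => (x i - a0 i) / m) = G (fun i => (y i - a0 i) / m) ↔
      LatticeCong (m * N) x y) := by
    intro x hx y hy
    rw [hG2]
    refine forall_congr' fun i => ?_
    obtain ⟨u, hu⟩ := (hA a0 ha0 x hx i).dvd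
    obtain ⟨v, hv⟩ := (hA a0 ha0 y hy i).dvd
    have hm' : (m : ℤ) ≠ 0 := by exact_mod_cast hm.ne'
    dsimp only
    rw [hu, hv, Int.mul_ediv_cancel_left _ hm', Int.mul_ediv_cancel_left _ hm', Int.modEq_iff_dvd,
      Int.modEq_iff_dvd]
    have : y i - x i = m * (v - u) := by linarith
    rw [this, Nat.cast_mul]
    exact (mul_dvd_mul_iff_left hm').symm
  obtain ⟨g, hg, hcard⟩ := Finset.exists_max_image (Finset.range (N ^ d))
    (fun g => (A.filter fun x => G (fun i => (x i - a0 i) / m) = g).card)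
    ⟨0, Finset.mem_range.2 (by positivity)⟩
  have hle : A.card ≤ N ^ d * (A.filter fun x => G (fun i => (x i - a0 i) / m) = g).card := by
    have := Finset.card_le_mul_card_image_of_maps_to (s := A) (t := Finset.range (N ^ d))
      (f := fun x => G (fun i => (x i - a0 i) / m))
      (fun x _ => Finset.mem_range.2 (hG1 _)) _ (fun b hb => hcard b hb)
    rw [Finset.card_range, mul_comm] at this
    exact this
  refine ⟨_, Finset.filter_subset _ _, hle, ?_, ?_, ?_⟩
  · intro hne
    rw [← Finset.card_pos] at hne ⊢
    exact Nat.pos_of_mul_pos_left (hne.trans_le hle)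
  · intro x hx y hy
    rw [Finset.mem_filter] at hx hy
    exact (key x hx.1 y hy.1).1 (hx.2.trans hy.2.symm)
  · intro x hx y hy hxy
    rw [Finset.mem_filter] at hy ⊢
    exact ⟨hx, ((key x hx y hy.1).2 hxy).trans hy.2⟩

theorem LatticeCong.eq_of_mem_cube {d n N : ℕ} (hN : n ≤ N) {x y : Fin d → ℤ}
    (hx : x ∈ latticeCube d n) (hy : y ∈ latticeCube d n) (h : LatticeCong N x y) : x = y := by
  funext i
  have h1 := mem_latticeCube.1 hx i
  have h2 := mem_latticeCube.1 hy i
  have hN' : (n : ℤ) ≤ N := by exact_mod_cast hN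
  have := h i
  rw [Int.ModEq, Int.emod_eq_of_lt h1.1 (by omega), Int.emod_eq_of_lt h2.1 (by omega)] at this
  exact this

/-- The first level at which a set of lattice points splits into several residue classes, and a
large residue class at that level. -/
theorem exists_split_level {d n q K k₀ : ℕ} (hq : 0 < q) (hK : n ≤ q ^ K)
    {A : Finset (Fin d → ℤ)} (hAn : A ⊆ latticeCube d n) (hA : 1 < A.card)
    (hcong : ∀ x ∈ A, ∀ y ∈ A, LatticeCong (q ^ k₀) x y) :
    ∃ k, k₀ ≤ k ∧ k < K ∧ (∀ x ∈ A, ∀ y ∈ A, LatticeCong (q ^ k) x y) ∧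
      ∃ A' ⊆ A, A.card ≤ q ^ d * A'.card ∧ A'.Nonempty ∧
        (∀ x ∈ A', ∀ y ∈ A', LatticeCong (q ^ (k + 1)) x y) ∧
        ∃ a ∈ A, ∀ b ∈ A', ¬ LatticeCong (q ^ (k + 1)) a b := by
  classical
  have hex : ∃ k, ¬ ∀ x ∈ A, ∀ y ∈ A, LatticeCong (q ^ (k + 1)) x y := by
    refine ⟨K, fun h => ?_⟩
    obtain ⟨x, hx, y, hy, hxy⟩ := Finset.one_lt_card.1 hA
    exact hxy (((h x hx y hy).of_dvd (pow_dvd_pow q (Nat.le_succ K))).eq_of_mem_cube hK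
      (hAn hx) (hAn hy))
  set k := Nat.find hex with hk
  have hk1 : ¬ ∀ x ∈ A, ∀ y ∈ A, LatticeCong (q ^ (k + 1)) x y := Nat.find_spec hex
  have hk0 : k₀ ≤ k := by
    by_contra hlt
    exact hk1 fun x hx y hy => (hcong x hx y hy).of_dvd (pow_dvd_pow q (by omega))
  have hk2 : ∀ x ∈ A, ∀ y ∈ A, LatticeCong (q ^ k) x y := by
    rcases Nat.eq_zero_or_pos k with h0 | hpos
    · rw [h0, pow_zero]; exact fun x _ y _ => LatticeCong.one x y
    · have := Nat.find_min hex (m := k - 1) (by omega)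
      rw [not_not, Nat.sub_add_cancel hpos] at this
      exact this
  have hkK : k < K := by
    by_contra hge
    obtain ⟨x, hx, y, hy, hxy⟩ := Finset.one_lt_card.1 hA
    exact hxy (((hk2 x hx y hy).of_dvd (pow_dvd_pow q (not_lt.1 hge))).eq_of_mem_cube hK
      (hAn hx) (hAn hy))
  obtain ⟨A', hA'A, hcard, hne, hA', hmem⟩ := exists_large_residue_class (m := q ^ k) (N := q)
    (by positivity) hq hk2
  refine ⟨k, hk0, hkK, hk2, A', hA'A, hcard, hne (Finset.card_pos.1 (by omega)), hA', ?_⟩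
  by_contra hno
  push Not at hno
  apply hk1
  have hall : ∀ x ∈ A, x ∈ A' := fun x hx => by
    obtain ⟨b, hb, hxb⟩ := hno x hx
    exact hmem x hx b hb hxb
  exact fun x hx y hy => hA' x (hall x hx) y (hall y hy)

/-- For one coordinate of the perturbation: a large residue class `A''` of `A`, and for each base
point `b` of it a residue class (that of `x`), such that a point `p` of the class can be moved
below or above by the points `y σ`. -/
theorem exists_coordinate_core {d n q K : ℕ} {B θ lam : ℝ} {F : (Fin d → ℤ) → ℝ} (hq : 0 < q)
    (hK : n ≤ q ^ K) (hF : Hierarchical q K B θ F) (hB : 1 ≤ B) (hθ : 0 < θ)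
    (hlam : lam ≤ 1) (hBθ : 8 * (B * θ) ≤ lam)
    {A : Finset (Fin d → ℤ)} (hAn : A ⊆ latticeCube d n) (hA : q ^ d < A.card) :
    ∃ A'' ⊆ A, A''.Nonempty ∧ A.card ≤ q ^ (2 * d) * A''.card ∧ ∃ m : ℕ,
      (∀ x ∈ A'', ∀ y ∈ A'', LatticeCong (q ^ m) x y) ∧
      ∀ b ∈ A'', ∃ x ∈ A, ∃ (ρ : ℝ) (g : ℝ → ℝ) (y : ℝ → (Fin d → ℤ)),
        (∀ z ∈ A'', |F z - F b| ≤ ρ) ∧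
        ∀ σ : ℝ, σ = 1 ∨ σ = -1 → y σ ∈ A ∧ θ ^ K ≤ g σ ∧ ρ ≤ B * θ * g σ ∧
          ∀ p, LatticeCong (q ^ m) x p →
            lam / 4 * g σ ≤ σ * (lam * (F (y σ) - F b) - (F p - F b)) - ρ ∧
            -(2 * (B * θ) * g σ) ≤ - σ * (F p - F b) - ρ := by
  have hqd : 1 ≤ q ^ d := Nat.one_le_pow _ _ hq
  obtain ⟨k, -, hkK, hAk, A', hA'A, hcard', -, hA'k, a, haA, ha⟩ :=
    exists_split_level (k₀ := 0) hq hK hAn (by omega)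
      (fun x _ y _ => by rw [pow_zero]; exact LatticeCong.one x y)
  have hA'1 : 1 < A'.card := by
    by_contra hle
    have : q ^ d * A'.card ≤ q ^ d * 1 := Nat.mul_le_mul_left _ (not_lt.1 hle)
    omega
  obtain ⟨m, hkm, hmK, hA'm, A'', hA''A', hcard'', hne, hA''m, a', ha'A', ha'⟩ :=
    exists_split_level (k₀ := k + 1) hq hK (hA'A.trans hAn) hA'1 hA'k
  refine ⟨A'', hA''A'.trans hA'A, hne, ?_, m + 1, hA''m, fun b hb => ?_⟩
  · calc A.card ≤ q ^ d * A'.card := hcard'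
      _ ≤ q ^ d * (q ^ d * A''.card) := Nat.mul_le_mul_left _ hcard''
      _ = q ^ (2 * d) * A''.card := by rw [two_mul, pow_add, mul_assoc]
  have hbA' := hA''A' hb
  have hbA := hA'A hbA'
  have h1 : θ ^ k / 2 ≤ |F a - F b| :=
    hF.le_abs_sub k hkK a b (hAk a haA b hbA) (ha b hbA')
  have h2 : θ ^ m / 2 ≤ |F a' - F b| :=
    hF.le_abs_sub m hmK a' b (hA'm a' ha'A' b hbA') (ha' b hb)
  have hθ1 : θ ≤ 1 := by nlinarith
  have hlam0 : 0 < lam := lt_of_lt_of_le (by positivity) hBθ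
  have hm1 : θ ^ m ≤ θ * θ ^ k := by
    rw [← pow_succ']; exact pow_le_pow_of_le_one hθ.le hθ1 hkm
  have hk0 : 0 < θ ^ k := by positivity
  have hm0 : 0 < θ ^ m := by positivity
  have hsucc : B * θ ^ (m + 1) = B * θ * θ ^ m := by rw [pow_succ]; ring
  have hBm : B * θ ^ m ≤ B * θ * θ ^ k := by nlinarith
  have hBθ0 : 0 < B * θ := by positivity
  have hmk : θ ^ m ≤ θ ^ k := by nlinarith
  have e1 : 8 * (B * θ * θ ^ k) ≤ lam * θ ^ k := by nlinarith
  have e2 : 8 * (B * θ * θ ^ m) ≤ lam * θ ^ m := by nlinarith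
  have e3 : B * θ * θ ^ m ≤ B * θ * θ ^ k := by nlinarith
  have e4 : lam * θ ^ m ≤ θ ^ m := by nlinarith
  have hgK : θ ^ K ≤ θ ^ m := pow_le_pow_of_le_one hθ.le hθ1 hmK.le
  obtain ⟨s, hs, hsa⟩ : ∃ s : ℝ, (s = 1 ∨ s = -1) ∧ θ ^ k / 2 ≤ s * (F a - F b) := by
    rcases le_abs'.1 h1 with h | h
    · exact ⟨-1, Or.inr rfl, by linarith⟩
    · exact ⟨1, Or.inl rfl, by linarith⟩
  have hsa' : θ ^ m / 2 ≤ s * (F a' - F b) ∨ θ ^ m / 2 ≤ -s * (F a' - F b) := by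
    rcases le_abs'.1 h2 with h | h <;> rcases hs with rfl | rfl
    · right; linarith
    · left; linarith
    · left; linarith
    · right; linarith
  have hcore : ∀ z ∈ A'', |F z - F b| ≤ B * θ ^ (m + 1) := fun z hz =>
    hF.abs_sub_le _ hmK z b (hA''m z hz b hb)
  have habs : ∀ c u : ℝ, |u| ≤ c → s * u ≤ c ∧ -s * u ≤ c := by
    intro c u hu
    rw [abs_le] at hu
    rcases hs with rfl | rfl <;> constructor <;> linarith
  have hσs : ∀ σ : ℝ, σ = 1 ∨ σ = -1 → σ = s ∨ (σ ≠ s ∧ σ = -s) := by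
    rintro σ (rfl | rfl) <;> rcases hs with rfl | rfl <;> norm_num
  rcases hsa' with hsa' | hsa'
  · refine ⟨a', hA'A ha'A', B * θ ^ (m + 1), fun σ => if σ = s then θ ^ k else θ ^ m,
      fun σ => if σ = s then a else b, hcore, fun σ hσ => ?_⟩
    have hp1 : ∀ p, LatticeCong (q ^ (m + 1)) a' p → s * (F a' - F p) ≤ B * θ ^ (m + 1) :=
      fun p hp => (habs _ _ (hF.abs_sub_le _ hmK a' p hp)).1
    have hp2 : ∀ p, LatticeCong (q ^ (m + 1)) a' p → s * (F p - F b) ≤ B * θ ^ m :=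
      fun p hp => (habs _ _ (hF.abs_sub_le _ hmK.le p b
        (((hp.of_dvd (pow_dvd_pow q (Nat.le_succ m))).symm).trans (hA'm a' ha'A' b hbA')))).1
    rcases hσs σ hσ with rfl | ⟨hne, rfl⟩
    · simp only [if_true]
      refine ⟨haA, by linarith, by linarith, fun p hp => ?_⟩
      have := hp2 p hp
      constructor
      · nlinarith
      · nlinarith
    · simp only [if_neg hne]
      refine ⟨hbA, hgK, by linarith, fun p hp => ?_⟩
      have := hp1 p hp
      constructor
      · nlinarith
      · nlinarith
  · refine ⟨b, hbA, B * θ ^ (m + 1), fun σ => if σ = s then θ ^ k else θ ^ m,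
      fun σ => if σ = s then a else a', hcore, fun σ hσ => ?_⟩
    have hp1 : ∀ p, LatticeCong (q ^ (m + 1)) b p → s * (F p - F b) ≤ B * θ ^ (m + 1) ∧
        - s * (F p - F b) ≤ B * θ ^ (m + 1) :=
      fun p hp => habs _ _ (hF.abs_sub_le _ hmK p b hp.symm)
    rcases hσs σ hσ with rfl | ⟨hne, rfl⟩
    · simp only [if_true]
      refine ⟨haA, by linarith, by linarith, fun p hp => ?_⟩
      have := hp1 p hp
      constructor
      · nlinarith
      · nlinarith
    · simp only [if_neg hne]
      refine ⟨hA'A ha'A', hgK, by linarith, fun p hp => ?_⟩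
      have := hp1 p hp
      constructor
      · nlinarith
      · nlinarith

/-- `p` is a convex combination of `a`, with weight `lam`, and of points of `Z`. -/
def ConvexCombo {d : ℕ} (Z : Finset (Fin d → ℤ)) (a : Fin d → ℤ) (lam : ℝ) (p : Fin d → ℤ) : Prop :=
  ∃ β : (Fin d → ℤ) → ℝ, (∀ z ∈ Z, 0 ≤ β z) ∧ ∑ z ∈ Z, β z = 1 ∧
    ∀ i, (p i : ℝ) = lam * a i + (1 - lam) * ∑ z ∈ Z, β z * z i

theorem ConvexCombo.mem_latticeCube {d n : ℕ} {Z : Finset (Fin d → ℤ)} {a p : Fin d → ℤ} {lam : ℝ}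
    (h : ConvexCombo Z a lam p) (h0 : 0 ≤ lam) (h1 : lam ≤ 1) (hZ : Z ⊆ latticeCube d n)
    (ha : a ∈ latticeCube d n) : p ∈ latticeCube d n := by
  obtain ⟨β, hβ, hsum, hp⟩ := h
  rw [_root_.mem_latticeCube]
  intro i
  have ha' := _root_.mem_latticeCube.1 ha i
  have hZ' : ∀ z ∈ Z, 0 ≤ z i ∧ z i < n := fun z hz => _root_.mem_latticeCube.1 (hZ hz) i
  have hlo : 0 ≤ ∑ z ∈ Z, β z * (z i : ℝ) :=
    Finset.sum_nonneg fun z hz => mul_nonneg (hβ z hz) (by exact_mod_cast (hZ' z hz).1)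
  have hhi : ∑ z ∈ Z, β z * (z i : ℝ) ≤ (n : ℝ) - 1 := by
    calc ∑ z ∈ Z, β z * (z i : ℝ) ≤ ∑ z ∈ Z, β z * ((n : ℝ) - 1) := by
          refine Finset.sum_le_sum fun z hz => mul_le_mul_of_nonneg_left ?_ (hβ z hz)
          have : (z i : ℝ) + 1 ≤ n := by exact_mod_cast (hZ' z hz).2
          linarith
      _ = (n : ℝ) - 1 := by rw [← Finset.sum_mul, hsum, one_mul]
  have a0 : (0 : ℝ) ≤ a i := by exact_mod_cast ha'.1
  have a1 : (a i : ℝ) + 1 ≤ n := by exact_mod_cast ha'.2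
  have hpi := hp i
  have p0 : (0 : ℝ) ≤ p i := by
    rw [hpi]; exact add_nonneg (mul_nonneg h0 a0) (mul_nonneg (by linarith) hlo)
  have p1 : (p i : ℝ) ≤ (n : ℝ) - 1 := by rw [hpi]; nlinarith
  constructor
  · exact_mod_cast p0
  · have : (p i : ℝ) < n := by linarith
    exact_mod_cast this

/-- The real vector of a lattice vector. -/
def realVec {d : ℕ} (x : Fin d → ℤ) : Fin d → ℝ := fun i => x i

theorem realVec_injective (d : ℕ) : Function.Injective (realVec (d := d)) := by
  intro x y h
  funext i
  have := congrFun h i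
  simpa [realVec] using this

/-- The span of the differences of points of `Z`. -/
def diffSpan {d : ℕ} (Z : Finset (Fin d → ℤ)) : Submodule ℝ (Fin d → ℝ) :=
  vectorSpan ℝ (realVec '' (Z : Set (Fin d → ℤ)))

theorem diffSpan_mono {d : ℕ} {Z A : Finset (Fin d → ℤ)} (h : Z ⊆ A) : diffSpan Z ≤ diffSpan A :=
  vectorSpan_mono ℝ (Set.image_mono (by exact_mod_cast h))

theorem sub_mem_diffSpan {d : ℕ} {Z : Finset (Fin d → ℤ)} {x y : Fin d → ℤ} (hx : x ∈ Z)
    (hy : y ∈ Z) : realVec x - realVec y ∈ diffSpan Z :=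
  vsub_mem_vectorSpan ℝ (Set.mem_image_of_mem _ (by exact_mod_cast hx))
    (Set.mem_image_of_mem _ (by exact_mod_cast hy))

theorem exists_small_spanning_subset {d : ℕ} {Z : Finset (Fin d → ℤ)} {b : Fin d → ℤ} (hb : b ∈ Z) :
    ∃ T ⊆ Z, T.card ≤ d ∧ ∀ v ∈ diffSpan Z, ∃ r : (Fin d → ℤ) → ℝ,
      v = ∑ z ∈ T, r z • (realVec z - realVec b) := by
  classical
  set f : (Fin d → ℤ) → (Fin d → ℝ) := fun z => realVec z - realVec b with hf
  have hfi : Function.Injective f := fun x y h => realVec_injective d (sub_left_injective h)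
  obtain ⟨s, hs, hspan, hli⟩ := exists_linearIndependent ℝ (f '' (Z : Set (Fin d → ℤ)))
  have hspanZ : diffSpan Z = Submodule.span ℝ s := by
    rw [hspan, diffSpan, vectorSpan_eq_span_vsub_set_right ℝ (Set.mem_image_of_mem realVec
      (Finset.mem_coe.2 hb)), Set.image_image]
    rfl
  refine ⟨Z.filter fun z => f z ∈ s, Finset.filter_subset _ _, ?_, fun v hv => ?_⟩
  · have hsfin : s.Finite := (Z.finite_toSet.image f).subset hs
    have := hsfin.fintype
    have h1 : Fintype.card s ≤ d := by
      have := hli.fintype_card_le_finrank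
      rwa [Module.finrank_fin_fun] at this
    refine le_trans ?_ h1
    rw [← Set.toFinset_card]
    refine Finset.card_le_card_of_injOn f (fun z hz => ?_) hfi.injOn
    simpa using (Finset.mem_filter.1 hz).2
  · have himg : s = f '' ((Z.filter fun z => f z ∈ s : Finset _) : Set (Fin d → ℤ)) := by
      ext v
      constructor
      · intro hvs
        obtain ⟨z, hz, rfl⟩ := hs hvs
        exact ⟨z, by simpa using ⟨hz, hvs⟩, rfl⟩
      · rintro ⟨z, hz, rfl⟩
        simpa using (Finset.mem_filter.1 hz).2
    rw [hspanZ, himg] at hv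
    obtain ⟨r, hr⟩ := (Submodule.mem_span_image_finset_iff_exists_fun' ℝ).1 hv
    exact ⟨r, hr.symm⟩

theorem convexCombo_of_coeffs {d : ℕ} {Z T : Finset (Fin d → ℤ)} (hT : T ⊆ Z) {b : Fin d → ℤ}
    (hb : b ∈ Z) {a p : Fin d → ℤ} {lam : ℝ} {γ : (Fin d → ℤ) → ℝ} (hγ : ∀ z ∈ T, 0 ≤ γ z)
    (hsum : ∑ z ∈ T, γ z ≤ 1)
    (hp : realVec p = lam • realVec a +
      (1 - lam) • (realVec b + ∑ z ∈ T, γ z • (realVec z - realVec b))) :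
    ConvexCombo Z a lam p := by
  classical
  have hif : ∀ h : (Fin d → ℤ) → ℝ, ∑ z ∈ Z, (if z ∈ T then γ z else 0) * h z = ∑ z ∈ T, γ z * h z := by
    intro h
    simp_rw [ite_mul, zero_mul]
    rw [← Finset.sum_filter, Finset.filter_mem_eq_inter, Finset.inter_eq_right.2 hT]
  have hif2 : ∀ (c : ℝ) (h : (Fin d → ℤ) → ℝ), ∑ z ∈ Z, (if z = b then c else 0) * h z = c * h b := by
    intro c h
    simp_rw [ite_mul, zero_mul]
    rw [Finset.sum_ite_eq' Z b, if_pos hb]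
  refine ⟨fun z => (if z ∈ T then γ z else 0) + (if z = b then 1 - ∑ z ∈ T, γ z else 0), ?_, ?_, ?_⟩
  · intro z _
    refine add_nonneg ?_ ?_
    · split_ifs with h
      · exact hγ z h
      · exact le_rfl
    · split_ifs
      · linarith
      · exact le_rfl
  · have h1 := hif fun _ => 1
    have h2 := hif2 (1 - ∑ z ∈ T, γ z) fun _ => 1
    simp only [mul_one] at h1 h2
    rw [Finset.sum_add_distrib, h1, h2]
    ring
  · intro i
    simp_rw [add_mul]
    rw [Finset.sum_add_distrib, hif fun z => (z i : ℝ), hif2 _ fun z => (z i : ℝ)]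
    have := congrFun hp i
    simp only [realVec, Pi.add_apply, Pi.smul_apply, smul_eq_mul, Finset.sum_apply,
      Pi.sub_apply] at this
    rw [this]
    simp_rw [mul_sub]
    rw [Finset.sum_sub_distrib, ← Finset.sum_mul]
    ring

open Filter Topology in
/-- A set of lattice points that are congruent modulo `(d + 1) * M` contains, in the relative
interior of its convex hull, points of every residue class modulo `M` of its affine span. -/
theorem exists_convexCombo_of_cong {d M : ℕ} (hM : 0 < M) {Z : Finset (Fin d → ℤ)}
    (hZ : ∀ z ∈ Z, ∀ z' ∈ Z, LatticeCong (M * (d + 1)) z z') {b x : Fin d → ℤ} (hb : b ∈ Z)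
    (hx : realVec x - realVec b ∈ diffSpan Z) :
    ∃ p, LatticeCong M x p ∧ ∀ a, realVec a - realVec b ∈ diffSpan Z →
      ∀ᶠ lam in 𝓝[>] (0 : ℝ), ConvexCombo Z a lam p := by
  classical
  obtain ⟨T, hTZ, hTd, hT⟩ := exists_small_spanning_subset hb
  obtain ⟨r, hr⟩ := hT _ hx
  have hM' : (0 : ℝ) < M := by exact_mod_cast hM
  have hu : ∀ z ∈ T, ∃ u : Fin d → ℤ, ∀ i, z i - b i = (M * (d + 1)) * u i := by
    intro z hz
    have h := fun i => (hZ b hb z (hTZ hz) i).dvd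
    choose u hu using h
    exact ⟨u, fun i => by rw [hu i]; push_cast; ring⟩
  choose! u hu using hu
  set R : ℝ := M * (d + 1) with hR
  have hR0 : 0 < R := by positivity
  set e : (Fin d → ℤ) → ℤ := fun z => 1 - ⌈r z * R / M⌉ with he
  set β : (Fin d → ℤ) → ℝ := fun z => r z + M * e z / R with hβ
  have hβ' : ∀ z, β z = (r z * R / M + e z) / (d + 1) := by
    intro z
    rw [hβ, hR]
    field_simp
  have hβ0 : ∀ z, 0 < β z := by
    intro z
    rw [hβ', he]
    have := Int.ceil_lt_add_one (r z * R / M)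
    apply div_pos _ (by positivity)
    push_cast
    linarith
  have hβ1 : ∀ z, β z ≤ 1 / (d + 1) := by
    intro z
    rw [hβ', he]
    have := Int.le_ceil (r z * R / M)
    apply div_le_div_of_nonneg_right _ (by positivity)
    push_cast
    linarith
  have hβsum : ∑ z ∈ T, β z < 1 := by
    calc ∑ z ∈ T, β z ≤ ∑ z ∈ T, (1 / (d + 1) : ℝ) := Finset.sum_le_sum fun z _ => hβ1 z
      _ = T.card / (d + 1) := by rw [Finset.sum_const, nsmul_eq_mul]; ring
      _ < 1 := by
          rw [div_lt_one (by positivity)]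
          have : (T.card : ℝ) ≤ d := by exact_mod_cast hTd
          linarith
  set p : Fin d → ℤ := fun i => x i + M * ∑ z ∈ T, e z * u z i with hp
  have hpb : realVec p = realVec b + ∑ z ∈ T, β z • (realVec z - realVec b) := by
    have h1 : realVec p = realVec x + ∑ z ∈ T, (M * e z / R : ℝ) • (realVec z - realVec b) := by
      funext i
      simp only [realVec, hp, Pi.add_apply, Finset.sum_apply, Pi.smul_apply, Pi.sub_apply,
        smul_eq_mul]
      push_cast
      rw [Finset.mul_sum]
      congr 1
      refine Finset.sum_congr rfl fun z hz => ?_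
      have : (z i : ℝ) - b i = R * u z i := by rw [hR]; exact_mod_cast hu z hz i
      rw [this]
      field_simp
    rw [h1, ← sub_add_cancel (realVec x) (realVec b), hr]
    simp only [hβ, add_smul, Finset.sum_add_distrib]
    abel
  refine ⟨p, fun i => ?_, fun a ha => ?_⟩
  · rw [Int.modEq_iff_dvd]
    exact ⟨∑ z ∈ T, e z * u z i, by simp [hp]⟩
  · obtain ⟨α, hα⟩ := hT _ ha
    have ev1 : ∀ᶠ lam in 𝓝[>] (0 : ℝ), ∀ z ∈ T, 0 < β z - lam * α z := by
      rw [Filter.eventually_all_finset]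
      intro z _
      refine nhdsWithin_le_nhds ?_
      have : Tendsto (fun lam : ℝ => β z - lam * α z) (𝓝 0) (𝓝 (β z - 0 * α z)) :=
        (Continuous.tendsto (by fun_prop) 0)
      exact this.eventually_const_lt (by simpa using hβ0 z)
    have ev2 : ∀ᶠ lam in 𝓝[>] (0 : ℝ), 0 < 1 - ∑ z ∈ T, β z - lam * (1 - ∑ z ∈ T, α z) := by
      refine nhdsWithin_le_nhds ?_
      have : Tendsto (fun lam : ℝ => 1 - ∑ z ∈ T, β z - lam * (1 - ∑ z ∈ T, α z)) (𝓝 0)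
          (𝓝 (1 - ∑ z ∈ T, β z - 0 * (1 - ∑ z ∈ T, α z))) :=
        (Continuous.tendsto (by fun_prop) 0)
      exact this.eventually_const_lt (by simpa using hβsum)
    have ev3 : ∀ᶠ lam in 𝓝[>] (0 : ℝ), lam < 1 :=
      nhdsWithin_le_nhds (Iio_mem_nhds one_pos)
    filter_upwards [ev1, ev2, ev3] with lam h1 h2 h3
    have h3' : 0 < 1 - lam := by linarith
    refine convexCombo_of_coeffs hTZ hb (γ := fun z => (β z - lam * α z) / (1 - lam))
      (fun z hz => (div_pos (h1 z hz) h3').le) ?_ ?_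
    · rw [← Finset.sum_div, div_le_one h3', Finset.sum_sub_distrib, ← Finset.mul_sum]
      linarith
    · rw [smul_add, Finset.smul_sum]
      have h4 : ∀ z ∈ T, (1 - lam) • ((β z - lam * α z) / (1 - lam)) • (realVec z - realVec b)
          = β z • (realVec z - realVec b) - lam • (α z • (realVec z - realVec b)) := by
        intro z _
        rw [smul_smul, mul_div_cancel₀ _ h3'.ne', sub_smul, mul_smul]
      rw [Finset.sum_congr rfl h4, Finset.sum_sub_distrib, ← Finset.smul_sum, ← hα, hpb]
      module

open Filter Topology in
/-- A weight that works for all configurations in the cube at the same time. -/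
theorem exists_uniform_weight (d n : ℕ) : ∃ lam : ℝ, 0 < lam ∧ lam < 1 ∧
    ∀ Z ⊆ latticeCube d n, ∀ a ∈ latticeCube d n, ∀ p ∈ latticeCube d n,
      (∀ᶠ lam in 𝓝[>] (0 : ℝ), ConvexCombo Z a lam p) → ConvexCombo Z a lam p := by
  have h1 : ∀ᶠ lam in 𝓝[>] (0 : ℝ), ∀ Z ∈ (latticeCube d n).powerset, ∀ a ∈ latticeCube d n,
      ∀ p ∈ latticeCube d n,
      (∀ᶠ lam in 𝓝[>] (0 : ℝ), ConvexCombo Z a lam p) → ConvexCombo Z a lam p := by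
    rw [Filter.eventually_all_finset]
    intro Z _
    rw [Filter.eventually_all_finset]
    intro a _
    rw [Filter.eventually_all_finset]
    intro p _
    by_cases h : ∀ᶠ lam in 𝓝[>] (0 : ℝ), ConvexCombo Z a lam p
    · exact h.mono fun _ h' _ => h'
    · exact Filter.Eventually.of_forall fun _ h' => absurd h' h
  have ev3 : ∀ᶠ lam in 𝓝[>] (0 : ℝ), lam < 1 := nhdsWithin_le_nhds (Iio_mem_nhds one_pos)
  obtain ⟨lam, ⟨h2, h3⟩, h4⟩ := ((h1.and ev3).and self_mem_nhdsWithin).exists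
  exact ⟨lam, h4, h3, fun Z hZ => h2 Z (Finset.mem_powerset.2 hZ)⟩

theorem Hierarchical.mono {d q K : ℕ} {B B' θ : ℝ} {F : (Fin d → ℤ) → ℝ}
    (h : Hierarchical q K B θ F) (hB : B ≤ B') (hθ : 0 ≤ θ) : Hierarchical q K B' θ F :=
  ⟨fun x => (h.abs_le x).trans hB,
    fun k hk x y hxy => (h.abs_sub_le k hk x y hxy).trans (by gcongr), h.le_abs_sub⟩

theorem exists_lattice_crt {d : ℕ} {N : Fin d → ℕ} (hN : Pairwise fun i j => (N i).Coprime (N j))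
    (b : Fin d → ℤ) (x : Fin d → (Fin d → ℤ)) :
    ∃ e : Fin d → ℤ, ∀ l, LatticeCong (N l) (x l) (fun j => b j + ∑ i, e i * (x i j - b j)) := by
  classical
  have hcop : ∀ i, IsCoprime (N i : ℤ) (∏ l ∈ Finset.univ.erase i, (N l : ℤ)) := fun i =>
    IsCoprime.prod_right fun l hl => (hN (Finset.ne_of_mem_erase hl).symm).isCoprime
  choose u v huv using hcop
  refine ⟨fun i => v i * ∏ l ∈ Finset.univ.erase i, (N l : ℤ), fun l j => ?_⟩
  rw [Int.modEq_iff_dvd]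
  dsimp only
  have hrest : (N l : ℤ) ∣ ∑ i ∈ Finset.univ.erase l,
      (v i * ∏ l ∈ Finset.univ.erase i, (N l : ℤ)) * (x i j - b j) := by
    refine Finset.dvd_sum fun i hi => ?_
    refine Dvd.dvd.mul_right (Dvd.dvd.mul_left ?_ _) _
    exact Finset.dvd_prod_of_mem _ (Finset.mem_erase.2 ⟨(Finset.ne_of_mem_erase hi).symm,
      Finset.mem_univ _⟩)
  rw [← Finset.add_sum_erase _ _ (Finset.mem_univ l)]
  have hl : v l * ∏ i ∈ Finset.univ.erase l, (N i : ℤ) = 1 - u l * N l := by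
    linarith [huv l]
  rw [hl]
  obtain ⟨c, hc⟩ := hrest
  rw [hc]
  exact ⟨c - u l * (x l j - b j), by ring⟩

theorem latticeCong_prod {d : ℕ} {N : Fin d → ℕ} (hN : Pairwise fun i j => (N i).Coprime (N j))
    {x y : Fin d → ℤ} (h : ∀ i, LatticeCong (N i) x y) : LatticeCong (∏ i, N i) x y := by
  intro j
  rw [Int.modEq_iff_dvd, Nat.cast_prod]
  exact Finset.prod_dvd_of_coprime
    (fun i _ l _ hil => (hN hil).isCoprime) fun i _ => (h i j).dvd

/-- Given test vectors `E i` whose coordinates are controlled by a steep hierarchy of scales, every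
nonzero linear functional is positive on one of them. -/
theorem exists_pos_test {d K : ℕ} {B η lam : ℝ} {θ w σ g : Fin d → ℝ} {E : Fin d → Fin d → ℝ}
    (hB : 0 < B) (hη : 0 < η) (hlam : 12 * B * η * d < lam)
    (hθ0 : ∀ i, 0 < θ i) (hθη : ∀ i, θ i ≤ η) (hθ : ∀ i l, i < l → θ i ≤ θ l ^ (K + 2))
    (hw : w ≠ 0) (hσ : ∀ i, w i = σ i * |w i|) (hg : ∀ i, θ i ^ K ≤ g i)
    (h1 : ∀ i, lam / 4 * g i ≤ σ i * E i i)
    (h2 : ∀ i l, l < i → -(3 * (B * θ l) * g l) ≤ σ l * E i l)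
    (h3 : ∀ i l, i < l → -(3 * B) ≤ σ l * E i l) :
    ∃ i, 0 < ∑ l, w l * E i l := by
  classical
  obtain ⟨j, hj⟩ := Function.ne_iff.1 hw
  have hg0 : ∀ i, 0 < g i := fun i => lt_of_lt_of_le (pow_pos (hθ0 i) K) (hg i)
  obtain ⟨i, -, hi⟩ := Finset.exists_max_image Finset.univ (fun i => |w i| * g i * θ i)
    ⟨j, Finset.mem_univ j⟩
  refine ⟨i, ?_⟩
  have hjpos : 0 < |w j| * g j * θ j := by
    have := abs_pos.2 hj
    have := hg0 j
    have := hθ0 j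
    positivity
  have hmax : ∀ l, |w l| * g l * θ l ≤ |w i| * g i * θ i := fun l => hi l (Finset.mem_univ l)
  have hwi : 0 < |w i| * g i := by
    have := hjpos.trans_le (hmax j)
    exact pos_of_mul_pos_left this (hθ0 i).le
  have hEσ : ∀ l, w l * E i l = |w l| * (σ l * E i l) := by
    intro l
    nth_rewrite 1 [hσ l]
    ring
  have hi' : |w i| * g i * (lam / 4) ≤ w i * E i i := by
    rw [hEσ, mul_assoc, mul_comm (g i)]
    exact mul_le_mul_of_nonneg_left (h1 i) (abs_nonneg _)
  have hl' : ∀ l ∈ Finset.univ.erase i, -(3 * B * η * (|w i| * g i)) ≤ w l * E i l := by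
    intro l hl
    have hne := Finset.ne_of_mem_erase hl
    rw [hEσ]
    rcases lt_or_gt_of_ne hne with h | h
    · have a1 := mul_le_mul_of_nonneg_left (h2 i l h) (abs_nonneg (w l))
      refine le_trans ?_ a1
      have a2 : |w i| * g i * θ i ≤ |w i| * g i * η := mul_le_mul_of_nonneg_left (hθη i) hwi.le
      have a3 := hmax l
      nlinarith
    · have a1 := mul_le_mul_of_nonneg_left (h3 i l h) (abs_nonneg (w l))
      refine le_trans ?_ a1
      have hp : 0 < θ l ^ (K + 1) := pow_pos (hθ0 l) _
      have a2 : |w l| * θ l ^ (K + 1) ≤ (|w i| * g i * η) * θ l ^ (K + 1) := by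
        calc |w l| * θ l ^ (K + 1) = |w l| * θ l ^ K * θ l := by rw [pow_succ]; ring
          _ ≤ |w l| * g l * θ l := by
              have := hg l
              have := hθ0 l
              gcongr
          _ ≤ |w i| * g i * θ i := hmax l
          _ ≤ |w i| * g i * θ l ^ (K + 2) := mul_le_mul_of_nonneg_left (hθ i l h) hwi.le
          _ = (|w i| * g i * θ l) * θ l ^ (K + 1) := by ring
          _ ≤ (|w i| * g i * η) * θ l ^ (K + 1) := by
              have := hθη l
              gcongr
      have a3 : |w l| ≤ |w i| * g i * η := le_of_mul_le_mul_right a2 hp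
      nlinarith
  rw [← Finset.add_sum_erase _ _ (Finset.mem_univ i)]
  have hsum := Finset.card_nsmul_le_sum _ _ _ hl'
  rw [nsmul_eq_mul, Finset.card_erase_of_mem (Finset.mem_univ i), Finset.card_univ,
    Fintype.card_fin] at hsum
  have hd1 : ((d - 1 : ℕ) : ℝ) ≤ d := by exact_mod_cast Nat.sub_le d 1
  have hpos : 0 ≤ 3 * B * η * (|w i| * g i) := by positivity
  have hlow : -((d : ℝ) * (3 * B * η * (|w i| * g i))) ≤
      ((d - 1 : ℕ) : ℝ) * -(3 * B * η * (|w i| * g i)) := by nlinarith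
  nlinarith

theorem exists_chain {α : Type*} (t : ℕ) (P : ℕ → α → Prop) (R : ℕ → α → α → Prop)
    (hstep : ∀ i < t, ∀ a, P i a → ∃ a', P (i + 1) a' ∧ R i a a') {a₀ : α} (h₀ : P 0 a₀) :
    ∃ S : ℕ → α, S 0 = a₀ ∧ P t (S t) ∧ ∀ i < t, R i (S i) (S (i + 1)) := by
  classical
  let f : ℕ → α → α := fun i a =>
    if h : ∃ a', P (i + 1) a' ∧ R i a a' then h.choose else a
  let S : ℕ → α := fun i => Nat.rec a₀ f i
  have hS : ∀ i, S (i + 1) = f i (S i) := fun i => rfl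
  have hf : ∀ i a, (∃ a', P (i + 1) a' ∧ R i a a') → P (i + 1) (f i a) ∧ R i a (f i a) := by
    intro i a h
    simp only [f, dif_pos h]
    exact h.choose_spec
  have hP : ∀ i ≤ t, P i (S i) := by
    intro i
    induction i with
    | zero => exact fun _ => h₀
    | succ i ih =>
      intro hi
      rw [hS]
      exact (hf i (S i) (hstep i hi _ (ih (by omega)))).1
  refine ⟨S, rfl, hP t le_rfl, fun i hi => ?_⟩
  rw [hS]
  exact (hf i (S i) (hstep i hi _ (hP i hi.le))).2

/-- If a convex combination of perturbed points lies beyond the perturbed point `p` in direction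
`w`, then so does one of the perturbed points. -/
theorem exists_pos_of_convexCombo {d : ℕ} {Z : Finset (Fin d → ℤ)} {a p : Fin d → ℤ} {lam τ : ℝ}
    (h0 : 0 ≤ lam) (h1 : lam ≤ 1) (hτ : 0 < τ) {w : Fin d → ℝ} {F : Fin d → (Fin d → ℤ) → ℝ}
    {β : (Fin d → ℤ) → ℝ} (hβ : ∀ z ∈ Z, 0 ≤ β z) (hsum : ∑ z ∈ Z, β z = 1)
    (hp : ∀ i, (p i : ℝ) = lam * a i + (1 - lam) * ∑ z ∈ Z, β z * z i)
    (hE : 0 < ∑ l, w l * (lam * F l a + (1 - lam) * ∑ z ∈ Z, β z * F l z - F l p)) :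
    ∃ z, (z = a ∨ z ∈ Z) ∧ 0 < ∑ l, w l * ((z l + τ * F l z) - (p l + τ * F l p)) := by
  by_contra hno
  push Not at hno
  set f : (Fin d → ℤ) → ℝ := fun z => ∑ l, w l * ((z l + τ * F l z) - (p l + τ * F l p)) with hf
  have ha : f a ≤ 0 := hno a (Or.inl rfl)
  have hz : ∑ z ∈ Z, β z * f z ≤ 0 :=
    Finset.sum_nonpos fun z hz => mul_nonpos_of_nonneg_of_nonpos (hβ z hz) (hno z (Or.inr hz))
  have hkey : τ * ∑ l, w l * (lam * F l a + (1 - lam) * ∑ z ∈ Z, β z * F l z - F l p)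
      = lam * f a + (1 - lam) * ∑ z ∈ Z, β z * f z := by
    simp only [hf]
    have hswap : ∑ z ∈ Z, β z * ∑ l, w l * ((z l + τ * F l z) - (p l + τ * F l p))
        = ∑ l, w l * (∑ z ∈ Z, β z * z l + τ * ∑ z ∈ Z, β z * F l z - (p l + τ * F l p)) := by
      simp_rw [Finset.mul_sum]
      rw [Finset.sum_comm]
      refine Finset.sum_congr rfl fun l _ => ?_
      have : (p l + τ * F l p : ℝ) = ∑ z ∈ Z, β z * (p l + τ * F l p) := by
        rw [← Finset.sum_mul, hsum, one_mul]
      rw [this, ← Finset.sum_add_distrib, ← Finset.sum_sub_distrib, Finset.mul_sum, ← this]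
      exact Finset.sum_congr rfl fun z _ => by ring
    rw [hswap, Finset.mul_sum, Finset.mul_sum, Finset.mul_sum, ← Finset.sum_add_distrib]
    refine Finset.sum_congr rfl fun l _ => ?_
    have := hp l
    linear_combination (w l) * this
  have : 0 < τ * ∑ l, w l * (lam * F l a + (1 - lam) * ∑ z ∈ Z, β z * F l z - F l p) :=
    mul_pos hτ hE
  nlinarith

/-- Large sets of lattice points surround a lattice point after the perturbation. -/
theorem exists_surrounded_of_large {d n K Q : ℕ} (hd : 0 < d) {q : Fin d → ℕ} (hq2 : ∀ i, 2 ≤ q i)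
    (hqQ : ∀ i, q i ≤ Q) (hcop : Pairwise fun i j => (q i).Coprime (q j))
    (hK : ∀ i, n ≤ q i ^ K) {B η lam τ : ℝ} {θ : Fin d → ℝ} {F : Fin d → (Fin d → ℤ) → ℝ}
    (hF : ∀ i, Hierarchical (q i) K B (θ i) (F i)) (hB : 1 ≤ B) (hη : 0 < η) (hτ : 0 < τ)
    (hlam0 : 0 < lam) (hlam1 : lam < 1) (hη1 : 12 * B * η * d < lam)
    (hθ0 : ∀ i, 0 < θ i) (hθη : ∀ i, θ i ≤ η) (hθ : ∀ i l, i < l → θ i ≤ θ l ^ (K + 2))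
    (hunif : ∀ Z ⊆ latticeCube d n, ∀ a ∈ latticeCube d n, ∀ p ∈ latticeCube d n,
      (∀ᶠ lam in nhdsWithin (0 : ℝ) (Set.Ioi 0), ConvexCombo Z a lam p) → ConvexCombo Z a lam p)
    (j : ℕ) : ∀ A ⊆ latticeCube d n, Module.finrank ℝ (diffSpan A) ≤ j →
      2 * ((d + 1) ^ d * (Q ^ (2 * d)) ^ d) ^ j ≤ A.card →
      ∃ p ∈ latticeCube d n, ∀ w : Fin d → ℝ, w ≠ 0 →
        ∃ a ∈ A, 0 < ∑ l, w l * ((a l + τ * F l a) - (p l + τ * F l p)) := by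
  classical
  have hQ : 2 ≤ Q := (hq2 ⟨0, hd⟩).trans (hqQ _)
  induction j with
  | zero =>
    intro A _ hrank hcard
    exfalso
    rw [pow_zero, mul_one] at hcard
    obtain ⟨x, hx, y, hy, hxy⟩ := Finset.one_lt_card.1 (show 1 < A.card by omega)
    have h0 : diffSpan A = ⊥ := Submodule.finrank_eq_zero.1 (by omega)
    have := sub_mem_diffSpan hx hy
    rw [h0, Submodule.mem_bot, sub_eq_zero] at this
    exact hxy (realVec_injective d this)
  | succ j ih =>
    intro A hAn hrank hcard
    set X := (d + 1) ^ d * (Q ^ (2 * d)) ^ d with hX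
    set T := (d + 1) ^ d * (2 * X ^ j) with hT
    have hX0 : 0 < X := by positivity
    have hT0 : 0 < T := by positivity
    have hη8 : ∀ i, 8 * (B * θ i) ≤ lam := by
      intro i
      have h1 : (1 : ℝ) ≤ d := by exact_mod_cast hd
      have h2 : B * θ i ≤ B * η := mul_le_mul_of_nonneg_left (hθη i) (by linarith)
      have h3 : 0 < B * η := by positivity
      nlinarith
    let R : ℕ → Finset (Fin d → ℤ) → Finset (Fin d → ℤ) → Prop := fun i S S' =>
      S' ⊆ S ∧ ∀ hi : i < d, ∃ m : ℕ, (∀ x ∈ S', ∀ y ∈ S', LatticeCong (q ⟨i, hi⟩ ^ m) x y) ∧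
      ∀ b ∈ S', ∃ x ∈ S, ∃ (ρ : ℝ) (g : ℝ → ℝ) (y : ℝ → (Fin d → ℤ)),
        (∀ z ∈ S', |F ⟨i, hi⟩ z - F ⟨i, hi⟩ b| ≤ ρ) ∧
        ∀ σ : ℝ, σ = 1 ∨ σ = -1 → y σ ∈ S ∧ θ ⟨i, hi⟩ ^ K ≤ g σ ∧ ρ ≤ B * θ ⟨i, hi⟩ * g σ ∧
          ∀ p, LatticeCong (q ⟨i, hi⟩ ^ m) x p →
            lam / 4 * g σ ≤ σ * (lam * (F ⟨i, hi⟩ (y σ) - F ⟨i, hi⟩ b)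
              - (F ⟨i, hi⟩ p - F ⟨i, hi⟩ b)) - ρ ∧
            -(2 * (B * θ ⟨i, hi⟩) * g σ) ≤ - σ * (F ⟨i, hi⟩ p - F ⟨i, hi⟩ b) - ρ
    obtain ⟨S, hS0, ⟨hSn, hSd⟩, hSR⟩ := exists_chain d
      (fun i S => S ⊆ latticeCube d n ∧ T * (Q ^ (2 * d)) ^ (d - i) ≤ S.card) R
      (by
        rintro i hi S ⟨hSn, hScard⟩
        have hqi := hqQ ⟨i, hi⟩
        have hqi2 := hq2 ⟨i, hi⟩
        have hlt : q ⟨i, hi⟩ ^ d < S.card := by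
          calc q ⟨i, hi⟩ ^ d < q ⟨i, hi⟩ ^ (2 * d) := Nat.pow_lt_pow_right hqi2 (by omega)
            _ ≤ Q ^ (2 * d) := Nat.pow_le_pow_left hqi _
            _ ≤ (Q ^ (2 * d)) ^ (d - i) := Nat.le_self_pow (by omega) _
            _ ≤ T * (Q ^ (2 * d)) ^ (d - i) := Nat.le_mul_of_pos_left _ hT0
            _ ≤ S.card := hScard
        obtain ⟨S', hS'S, -, hcard', m, hm, hdata⟩ := exists_coordinate_core (by omega)
          (hK ⟨i, hi⟩) (hF ⟨i, hi⟩) hB (hθ0 _) hlam1.le (hη8 _) hSn hlt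
        refine ⟨S', ⟨hS'S.trans hSn, ?_⟩, hS'S, fun _ => ⟨m, hm, hdata⟩⟩
        have hpow : (Q ^ (2 * d)) ^ (d - i) = Q ^ (2 * d) * (Q ^ (2 * d)) ^ (d - (i + 1)) := by
          rw [← pow_succ']
          congr 1
          omega
        have h1 : Q ^ (2 * d) * (T * (Q ^ (2 * d)) ^ (d - (i + 1))) ≤ Q ^ (2 * d) * S'.card := by
          calc _ = T * (Q ^ (2 * d)) ^ (d - i) := by rw [hpow]; ring
            _ ≤ S.card := hScard
            _ ≤ q ⟨i, hi⟩ ^ (2 * d) * S'.card := hcard'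
            _ ≤ Q ^ (2 * d) * S'.card :=
              Nat.mul_le_mul_right _ (Nat.pow_le_pow_left hqi _)
        exact Nat.le_of_mul_le_mul_left h1 (by positivity))
      (a₀ := A) ⟨hAn, by
        refine le_trans (le_of_eq ?_) hcard
        rw [hT, Nat.sub_zero, pow_succ, hX]
        ring⟩
    rw [Nat.sub_self, pow_zero, mul_one] at hSd
    have hanti : ∀ k i, i ≤ k → k ≤ d → S k ⊆ S i := by
      intro k i hik
      induction k, hik using Nat.le_induction with
      | base => exact fun _ => subset_rfl
      | succ k hik ih' => exact fun hk => ((hSR k (by omega)).1).trans (ih' (by omega))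
    have hSA : ∀ i ≤ d, S i ⊆ A := fun i hi => hS0 ▸ hanti i 0 (by omega) hi
    have hdata := fun i : Fin d => (hSR i i.2).2 i.2
    choose m hm hdata using hdata
    have hcopN : Pairwise fun i l => (q i ^ m i).Coprime (q l ^ m l) :=
      fun i l hil => Nat.Coprime.pow _ _ (hcop hil)
    set M := ∏ i, q i ^ m i with hM
    have hM0 : 0 < M := Finset.prod_pos fun i _ => pow_pos (by have := hq2 i; omega) _
    have hSdM : ∀ x ∈ S d, ∀ y ∈ S d, LatticeCong M x y := fun x hx y hy =>
      latticeCong_prod hcopN fun i => hm i x (hanti d (i + 1) (by omega) le_rfl hx) y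
        (hanti d (i + 1) (by omega) le_rfl hy)
    obtain ⟨Z, hZS, hZcard, -, hZM, -⟩ :=
      exists_large_residue_class (N := d + 1) hM0 (by omega) hSdM
    have hZA : Z ⊆ A := hZS.trans (hSA d le_rfl)
    have hZ2 : 2 * X ^ j ≤ Z.card :=
      Nat.le_of_mul_le_mul_left (hSd.trans hZcard) (by positivity)
    by_cases hZj : Module.finrank ℝ (diffSpan Z) ≤ j
    · obtain ⟨p, hp, hpw⟩ := ih Z (hZA.trans hAn) hZj hZ2
      refine ⟨p, hp, fun w hw => ?_⟩
      obtain ⟨a, ha, h0⟩ := hpw w hw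
      exact ⟨a, hZA ha, h0⟩
    have hspan : diffSpan Z = diffSpan A :=
      Submodule.eq_of_le_of_finrank_le (diffSpan_mono hZA) (by omega)
    obtain ⟨b, hb⟩ : Z.Nonempty := by
      rw [← Finset.card_pos]
      exact lt_of_lt_of_le (by positivity) hZ2
    have hbS : ∀ i ≤ d, b ∈ S i := fun i hi => hanti d i hi le_rfl (hZS hb)
    choose x hxS ρ g y hρ hy using fun i : Fin d => hdata i b (hbS (i + 1) (by omega))
    obtain ⟨e, he⟩ := exists_lattice_crt hcopN b x
    have hdiffA : ∀ a ∈ A, realVec a - realVec b ∈ diffSpan Z := fun a ha =>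
      hspan ▸ sub_mem_diffSpan ha (hZA hb)
    have hxmem : realVec (fun j => b j + ∑ i, e i * (x i j - b j)) - realVec b ∈ diffSpan Z := by
      have : realVec (fun j => b j + ∑ i, e i * (x i j - b j)) - realVec b
          = ∑ i, (e i : ℝ) • (realVec (x i) - realVec b) := by
        funext j
        simp [realVec]
      rw [this]
      exact Submodule.sum_mem _ fun i _ => Submodule.smul_mem _ _
        (hdiffA _ (hSA i (by omega) (hxS i)))
    obtain ⟨p, hxp, hp⟩ := exists_convexCombo_of_cong hM0 hZM hb hxmem
    have hpn : p ∈ latticeCube d n := by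
      have ev : ∀ᶠ lam in nhdsWithin (0 : ℝ) (Set.Ioi 0), lam < 1 :=
        nhdsWithin_le_nhds (Iio_mem_nhds one_pos)
      obtain ⟨μ, ⟨h1, h2⟩, h3⟩ :=
        (((hp b (by simp)).and ev).and self_mem_nhdsWithin).exists
      exact h1.mem_latticeCube (le_of_lt h3) h2.le (hZA.trans hAn) (hAn (hZA hb))
    have hcombo : ∀ a ∈ A, ConvexCombo Z a lam p := fun a ha =>
      hunif Z (hZA.trans hAn) a (hAn ha) p hpn (hp a (hdiffA a ha))
    have hxip : ∀ i, LatticeCong (q i ^ m i) (x i) p := fun i =>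
      (he i).trans (hxp.of_dvd (Finset.dvd_prod_of_mem _ (Finset.mem_univ i)))
    refine ⟨p, hpn, fun w hw => ?_⟩
    set σ : Fin d → ℝ := fun i => if 0 ≤ w i then 1 else -1 with hσ
    have hσ1 : ∀ i, σ i = 1 ∨ σ i = -1 := by
      intro i
      simp only [hσ]
      split_ifs <;> simp
    have hwσ : ∀ i, w i = σ i * |w i| := by
      intro i
      simp only [hσ]
      split_ifs with h
      · rw [abs_of_nonneg h, one_mul]
      · rw [abs_of_neg (not_le.1 h)]; ring
    have hyA : ∀ i, y i (σ i) ∈ A := fun i => hSA i (by omega) (hy i (σ i) (hσ1 i)).1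
    choose β hβ0 hβ1 hβp using fun i => hcombo (y i (σ i)) (hyA i)
    have havg : ∀ i l, ∑ z ∈ Z, β i z * F l z - F l b = ∑ z ∈ Z, β i z * (F l z - F l b) := by
      intro i l
      simp_rw [mul_sub]
      rw [Finset.sum_sub_distrib, ← Finset.sum_mul, hβ1, one_mul]
    have havgρ : ∀ i l, |∑ z ∈ Z, β i z * F l z - F l b| ≤ ρ l := by
      intro i l
      rw [havg]
      calc |∑ z ∈ Z, β i z * (F l z - F l b)| ≤ ∑ z ∈ Z, |β i z * (F l z - F l b)| :=
            Finset.abs_sum_le_sum_abs _ _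
        _ ≤ ∑ z ∈ Z, β i z * ρ l := by
            refine Finset.sum_le_sum fun z hz => ?_
            rw [abs_mul, abs_of_nonneg (hβ0 i z hz)]
            exact mul_le_mul_of_nonneg_left
              (hρ l z (hanti d (l + 1) (by omega) le_rfl (hZS hz))) (hβ0 i z hz)
        _ = ρ l := by rw [← Finset.sum_mul, hβ1, one_mul]
    have havgB : ∀ i l, |∑ z ∈ Z, β i z * F l z| ≤ B := by
      intro i l
      calc |∑ z ∈ Z, β i z * F l z| ≤ ∑ z ∈ Z, |β i z * F l z| :=
            Finset.abs_sum_le_sum_abs _ _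
        _ ≤ ∑ z ∈ Z, β i z * B := by
            refine Finset.sum_le_sum fun z hz => ?_
            rw [abs_mul, abs_of_nonneg (hβ0 i z hz)]
            exact mul_le_mul_of_nonneg_left ((hF l).abs_le z) (hβ0 i z hz)
        _ = B := by rw [← Finset.sum_mul, hβ1, one_mul]
    have hσabs : ∀ l (u : ℝ) c, |u| ≤ c → -c ≤ σ l * u := by
      intro l u c hu
      rw [abs_le] at hu
      rcases hσ1 l with h | h <;> rw [h] <;> linarith
    have hρ0 : ∀ l, 0 ≤ ρ l := fun l => (abs_nonneg _).trans (havgρ l l)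
    obtain ⟨i, hi⟩ := exists_pos_test (K := K) (B := B) (η := η) (lam := lam) (θ := θ) (w := w)
      (σ := σ) (g := fun i => g i (σ i))
      (E := fun i l => lam * F l (y i (σ i)) + (1 - lam) * ∑ z ∈ Z, β i z * F l z - F l p)
      (by linarith) hη hη1 hθ0 hθη hθ hw hwσ (fun i => (hy i (σ i) (hσ1 i)).2.1)
      (by
        intro i
        have h1 := ((hy i (σ i) (hσ1 i)).2.2.2 p (hxip i)).1
        have h2 := hσabs i _ _ (havgρ i i)
        have h3 := hρ0 i
        have h4 : -ρ i ≤ (1 - lam) * (σ i * (∑ z ∈ Z, β i z * F i z - F i b)) := by nlinarith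
        linarith)
      (by
        intro i l hli
        have h1 := ((hy l (σ l) (hσ1 l)).2.2.2 p (hxip l)).2
        have h2 := hσabs l _ _ (havgρ i l)
        have h3 := hρ0 l
        have h4 : -((1 - lam) * ρ l) ≤ (1 - lam) * (σ l * (∑ z ∈ Z, β i z * F l z - F l b)) := by
          nlinarith
        have h5 : y i (σ i) ∈ S (l + 1) := hanti i (l + 1) (by
          have : (l : ℕ) < i := hli
          omega) (by omega) (hy i (σ i) (hσ1 i)).1
        have h6 := hσabs l _ _ (hρ l _ h5)
        have h7 : -(lam * ρ l) ≤ lam * (σ l * (F l (y i (σ i)) - F l b)) := by nlinarith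
        have h8 := (hy l (σ l) (hσ1 l)).2.2.1
        have h9 : 0 ≤ B * θ l * g l (σ l) := h3.trans h8
        linarith)
      (by
        intro i l _
        have h1 := hσabs l _ _ (havgB i l)
        have h2 := hσabs l _ _ ((hF l).abs_le (y i (σ i)))
        have h3 : |-F l p| ≤ B := by rw [abs_neg]; exact (hF l).abs_le p
        have h4 := hσabs l _ _ h3
        nlinarith)
    obtain ⟨z, hz, hpos⟩ := exists_pos_of_convexCombo hlam0.le hlam1.le hτ (hβ0 i) (hβ1 i) (hβp i) hi
    rcases hz with rfl | hz
    · exact ⟨_, hyA i, hpos⟩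
    · exact ⟨z, hZA hz, hpos⟩

theorem le_primeCounting_pow_four {d : ℕ} (hd : 3 ≤ d) : d ≤ Nat.primeCounting (d ^ 4) := by
  by_contra hlt
  set n := d ^ 4 with hn
  have hn81 : 81 ≤ n := by
    calc 81 = 3 ^ 4 := by norm_num
      _ ≤ d ^ 4 := Nat.pow_le_pow_left hd 4
  have hn' : (81 : ℝ) ≤ n := by exact_mod_cast hn81
  have hd' : (3 : ℝ) ≤ d := by exact_mod_cast hd
  have hπ : ((Nat.primeCounting n : ℕ) : ℝ) ≤ d - 1 := by
    have : Nat.primeCounting n + 1 ≤ d := by omega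
    have : ((Nat.primeCounting n : ℕ) : ℝ) + 1 ≤ d := by exact_mod_cast this
    linarith
  have h1 := Chebyshev.psi_ge n
  have h2 := Chebyshev.psi_le_primeCounting_mul_log n
  have hlog0 : 0 ≤ Real.log n := Real.log_nonneg (by linarith)
  have h3 : Real.log ((n : ℝ) + 1) ≤ Real.log 2 + Real.log n := by
    rw [← Real.log_mul (by norm_num) (by positivity)]
    exact Real.log_le_log (by positivity) (by linarith)
  have hl2 : 0 < Real.log 2 := Real.log_pos (by norm_num)
  have h4 : Real.log d ≤ d * Real.log 2 := by
    rw [← Real.log_pow]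
    apply Real.log_le_log (by positivity)
    exact_mod_cast Nat.lt_two_pow_self.le
  have h5 : Real.log n = 4 * Real.log d := by
    rw [hn, Nat.cast_pow, Real.log_pow]; norm_num
  have h6 : (Nat.primeCounting n : ℝ) * Real.log n ≤ (d - 1) * Real.log n :=
    mul_le_mul_of_nonneg_right hπ hlog0
  have h7 : (n : ℝ) * Real.log 2 ≤ Real.log 2 + d * Real.log n := by linarith
  have h8 : (n : ℝ) * Real.log 2 ≤ (1 + 4 * d ^ 2) * Real.log 2 := by
    rw [h5] at h7
    nlinarith
  have h9 := le_of_mul_le_mul_right h8 hl2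
  have h10 : (n : ℝ) = (d : ℝ) ^ 2 * (d : ℝ) ^ 2 := by rw [hn]; push_cast; ring
  nlinarith

theorem exists_coprime_bases {d : ℕ} (hd : 3 ≤ d) : ∃ q : Fin d → ℕ, (∀ i, 2 ≤ q i) ∧
    (∀ i, q i ≤ d ^ 4) ∧ Pairwise fun i j => (q i).Coprime (q j) := by
  have hinf := Nat.infinite_setOfPred_prime
  refine ⟨fun i => Nat.nth Nat.Prime i, fun i => (Nat.prime_nth_prime i).two_le, fun i => ?_,
    fun i j hij => ?_⟩
  · apply Nat.lt_succ_iff.1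
    apply Nat.nth_lt_of_lt_count
    exact lt_of_lt_of_le i.2 (le_primeCounting_pow_four hd)
  · refine (Nat.coprime_primes (Nat.prime_nth_prime _) (Nat.prime_nth_prime _)).2 fun h => ?_
    exact hij (Fin.ext (Nat.nth_injective hinf h))

/-- The size from which on a set of points of the perturbed lattice cannot be a hole. -/
def holeBound (d : ℕ) : ℕ := 2 * ((d + 1) ^ d * ((d ^ 4) ^ (2 * d)) ^ d) ^ d

theorem holeBound_le {d : ℕ} (hd : 2 ≤ d) : holeBound d ≤ d ^ (11 * d ^ 3) := by
  have h1 : d + 1 ≤ d ^ 2 := by nlinarith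
  calc holeBound d ≤ d * ((d ^ 2) ^ d * ((d ^ 4) ^ (2 * d)) ^ d) ^ d := by
        unfold holeBound
        gcongr
    _ = d ^ (1 + 2 * d ^ 2 + 8 * d ^ 3) := by
        rw [← pow_mul, ← pow_mul, ← pow_mul, ← pow_add, ← pow_mul, ← pow_succ']
        congr 1
        ring
    _ ≤ d ^ (11 * d ^ 3) := by
        apply Nat.pow_le_pow_right (by omega)
        have h2 : d ^ 2 ≤ d ^ 3 := Nat.pow_le_pow_right (by omega) (by norm_num)
        have h3 : 1 ≤ d ^ 3 := Nat.one_le_pow _ _ (by omega)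
        omega

theorem exists_perturbation_holeFree {d : ℕ} (hd : 3 ≤ d) (n : ℕ) :
    ∃ Φ : (Fin d → ℤ) → EuclideanSpace ℝ (Fin d),
      (∀ x i, |Φ x i - x i| ≤ 1 / 4) ∧ HoleFree (holeBound d) (Φ '' (latticeCube d n)) := by
  obtain ⟨q, hq2, hqQ, hcop⟩ := exists_coprime_bases hd
  obtain ⟨lam, hlam0, hlam1, hunif⟩ := exists_uniform_weight d n
  choose B' hB'1 hB' using fun i => exists_hierarchical d n (q := q i) (by have := hq2 i; omega)
  set B : ℝ := 1 + ∑ i, B' i with hBdef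
  have hB'0 : ∀ i, 0 ≤ B' i := fun i => zero_le_one.trans (hB'1 i)
  have hB1 : 1 ≤ B := by
    have : 0 ≤ ∑ i, B' i := Finset.sum_nonneg fun i _ => hB'0 i
    linarith
  have hBB : ∀ i, B' i ≤ B := by
    intro i
    have := Finset.single_le_sum (f := B') (fun i _ => hB'0 i) (Finset.mem_univ i)
    linarith
  have hd' : (3 : ℝ) ≤ d := by exact_mod_cast hd
  set η : ℝ := lam / (24 * B * d) with hη
  have hη0 : 0 < η := by positivity
  have hη1 : 12 * B * η * d < lam := by
    have : 12 * B * η * d = lam / 2 := by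
      rw [hη]
      field_simp
      norm_num
    linarith
  have hBη : 2 * (B * η) ≤ 1 := by
    have : 0 < B * η := by positivity
    nlinarith
  have hηle : η ≤ 1 := by nlinarith
  set θ : Fin d → ℝ := fun i => η ^ ((n + 2) ^ (d - (i : ℕ))) with hθ
  have hθ0 : ∀ i, 0 < θ i := fun i => pow_pos hη0 _
  have hθη : ∀ i, θ i ≤ η := fun i =>
    (pow_le_pow_of_le_one hη0.le hηle (Nat.one_le_pow _ _ (by omega))).trans_eq (pow_one η)
  have hθθ : ∀ i l, i < l → θ i ≤ θ l ^ (n + 2) := by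
    intro i l hil
    rw [hθ]
    dsimp only
    rw [← pow_mul, ← pow_succ]
    apply pow_le_pow_of_le_one hη0.le hηle
    apply Nat.pow_le_pow_right (by omega)
    have : (i : ℕ) < l := hil
    omega
  have hFex : ∀ i, ∃ F : (Fin d → ℤ) → ℝ, Hierarchical (q i) n B (θ i) F := by
    intro i
    obtain ⟨F, hF⟩ := hB' i (θ i) (hθ0 i) (by
      have h1 : B' i * θ i ≤ B * η :=
        mul_le_mul (hBB i) (hθη i) (hθ0 i).le (by linarith)
      linarith)
    exact ⟨F, hF.mono (hBB i) (hθ0 i).le⟩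
  choose F hF using hFex
  set τ : ℝ := 1 / (4 * B) with hτ
  have hτ0 : 0 < τ := by positivity
  set Φ : (Fin d → ℤ) → EuclideanSpace ℝ (Fin d) := fun x =>
    WithLp.toLp 2 fun i => x i + τ * F i x with hΦ
  have hnear : ∀ x i, |Φ x i - x i| ≤ 1 / 4 := by
    intro x i
    have h1 : Φ x i - x i = τ * F i x := by simp [hΦ]
    rw [h1, abs_mul, abs_of_pos hτ0]
    calc τ * |F i x| ≤ τ * B := mul_le_mul_of_nonneg_left ((hF i).abs_le x) hτ0.le
      _ = 1 / 4 := by rw [hτ]; field_simp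
  refine ⟨Φ, hnear, holeFree_image_latticeCube (by omega) hnear fun A hA hcard => ?_⟩
  have hK : ∀ i, n ≤ q i ^ n := fun i =>
    Nat.lt_two_pow_self.le.trans (Nat.pow_le_pow_left (hq2 i) n)
  obtain ⟨p, hp, hpw⟩ := exists_surrounded_of_large (by omega) hq2 hqQ hcop hK hF hB1 hη0 hτ0 hlam0
    hlam1 hη1 hθ0 hθη hθθ hunif d A hA
    ((Submodule.finrank_le _).trans_eq (Module.finrank_fin_fun ℝ)) hcard.ge
  refine ⟨p, hp, fun w hw => ?_⟩
  obtain ⟨a, ha, hpos⟩ := hpw (fun i => w i) (fun h => hw (by ext i; exact congrFun h i))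
  refine ⟨a, ha, ?_⟩
  rw [PiLp.inner_apply]
  convert hpos using 2 with l
  simp [hΦ, mul_comm]

/-- `p` is surrounded by `A`: no linear functional attains its maximum over `A ∪ {p}` at `p`. -/
def PlaneSurrounded (A : Finset (ℤ × ℤ)) (p : ℤ × ℤ) : Prop :=
  ∀ α β : ℝ, α ≠ 0 ∨ β ≠ 0 → ∃ a ∈ A, 0 < α * (a.1 - p.1) + β * (a.2 - p.2)

/-- The point `(x, y)` is dominated by `A` in every direction. -/
def PlaneDominated (A : Finset (ℤ × ℤ)) (x y : ℝ) : Prop :=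
  ∀ α β : ℝ, ∃ a ∈ A, α * x + β * y ≤ α * a.1 + β * a.2

theorem planeDominated_of_mem {A : Finset (ℤ × ℤ)} {a : ℤ × ℤ} (ha : a ∈ A) :
    PlaneDominated A a.1 a.2 := fun _ _ => ⟨a, ha, le_rfl⟩

theorem PlaneDominated.combo {A : Finset (ℤ × ℤ)} {x y x' y' t : ℝ} (h : PlaneDominated A x y)
    (h' : PlaneDominated A x' y') (h0 : 0 ≤ t) (h1 : t ≤ 1) :
    PlaneDominated A ((1 - t) * x + t * x') ((1 - t) * y + t * y') := by
  intro α β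
  rcases le_total (α * x + β * y) (α * x' + β * y') with hle | hle
  · obtain ⟨a, ha, hle'⟩ := h' α β
    exact ⟨a, ha, by nlinarith⟩
  · obtain ⟨a, ha, hle'⟩ := h α β
    exact ⟨a, ha, by nlinarith⟩

theorem planeSurrounded_of_cross {A : Finset (ℤ × ℤ)} {l r : ℝ} {p : ℤ × ℤ}
    (hl : PlaneDominated A l p.2) (hr : PlaneDominated A r p.2) (hlp : l < p.1) (hpr : p.1 < r)
    (habove : ∃ a ∈ A, p.2 < a.2) (hbelow : ∃ a ∈ A, a.2 < p.2) : PlaneSurrounded A p := by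
  intro α β hαβ
  rcases lt_trichotomy α 0 with h | h | h
  · obtain ⟨a, ha, hle⟩ := hl α β
    exact ⟨a, ha, by nlinarith⟩
  · subst h
    rcases lt_or_gt_of_ne (hαβ.resolve_left (by simp)) with h | h
    · obtain ⟨a, ha, hlt⟩ := hbelow
      have : (a.2 : ℝ) < p.2 := by exact_mod_cast hlt
      exact ⟨a, ha, by nlinarith⟩
    · obtain ⟨a, ha, hlt⟩ := habove
      have : (p.2 : ℝ) < a.2 := by exact_mod_cast hlt
      exact ⟨a, ha, by nlinarith⟩
  · obtain ⟨a, ha, hle⟩ := hr α β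
    exact ⟨a, ha, by nlinarith⟩

theorem planeSurrounded_of_row {A : Finset (ℤ × ℤ)} {c : ℤ}
    (h3 : 3 ≤ (A.filter fun a => a.2 = c).card)
    (habove : ∃ a ∈ A, c < a.2) (hbelow : ∃ a ∈ A, a.2 < c) : ∃ p, PlaneSurrounded A p := by
  classical
  set S := A.filter fun a => a.2 = c with hS
  have hne : S.Nonempty := by rw [← Finset.card_pos]; omega
  obtain ⟨l, hl, hlmin⟩ := S.exists_min_image (fun a => a.1) hne
  obtain ⟨r, hr, hrmax⟩ := S.exists_max_image (fun a => a.1) hne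
  have hcard : 0 < ((S.erase l).erase r).card := by
    have h1 := Finset.pred_card_le_card_erase (s := S) (a := l)
    have h2 := Finset.pred_card_le_card_erase (s := S.erase l) (a := r)
    omega
  obtain ⟨p, hp⟩ := Finset.card_pos.1 hcard
  rw [Finset.mem_erase, Finset.mem_erase] at hp
  obtain ⟨hpr, hpl, hpS⟩ := hp
  have hl' := Finset.mem_filter.1 hl
  have hr' := Finset.mem_filter.1 hr
  have hp' := Finset.mem_filter.1 hpS
  have hlp : l.1 < p.1 := lt_of_le_of_ne (hlmin p hpS) fun h =>
    hpl (Prod.ext h.symm (hp'.2.trans hl'.2.symm))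
  have hpr' : p.1 < r.1 := lt_of_le_of_ne (hrmax p hpS) fun h =>
    hpr (Prod.ext h (hp'.2.trans hr'.2.symm))
  refine ⟨p, planeSurrounded_of_cross (l := l.1) (r := r.1) ?_ ?_ (by exact_mod_cast hlp)
    (by exact_mod_cast hpr') (by rwa [hp'.2]) (by rwa [hp'.2])⟩
  · rw [hp'.2, ← hl'.2]; exact planeDominated_of_mem hl'.1
  · rw [hp'.2, ← hr'.2]; exact planeDominated_of_mem hr'.1

theorem planeSurrounded_of_triangle {A : Finset (ℤ × ℤ)} (hl : PlaneDominated A (-1) 0)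
    (hr : PlaneDominated A 1 0) {x y m : ℤ} (hy : 2 ≤ y) (hxy : PlaneDominated A x y)
    (h1 : x - (y - 1) < m * y) (h2 : m * y < x + (y - 1)) : PlaneSurrounded A (m, 1) := by
  have hy' : (2 : ℝ) ≤ y := by exact_mod_cast hy
  have hy0 : (0 : ℝ) < y := by linarith
  have h1' : (x : ℝ) - (y - 1) < m * y := by exact_mod_cast h1
  have h2' : (m : ℝ) * y < x + (y - 1) := by exact_mod_cast h2
  have ht0 : (0 : ℝ) ≤ 1 / y := by positivity
  have ht1 : (1 : ℝ) / y ≤ 1 := by rw [div_le_one hy0]; linarith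
  have hone : (1 - 1 / (y : ℝ)) * 0 + 1 / y * y = ((1 : ℤ) : ℝ) := by
    field_simp; norm_num
  have hL := hl.combo hxy ht0 ht1
  have hR := hr.combo hxy ht0 ht1
  rw [hone] at hL hR
  refine planeSurrounded_of_cross (p := (m, 1)) hL hR ?_ ?_ ?_ ?_
  · have : (1 - 1 / (y : ℝ)) * -1 + 1 / y * x = (x - (y - 1)) / y := by field_simp; ring
    rw [this, div_lt_iff₀ hy0]; exact h1'
  · have : (1 - 1 / (y : ℝ)) * 1 + 1 / y * x = (x + (y - 1)) / y := by field_simp; ring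
    rw [this, lt_div_iff₀ hy0]; exact h2'
  · obtain ⟨a, ha, hle⟩ := hxy 0 1
    refine ⟨a, ha, ?_⟩
    have : (y : ℝ) ≤ a.2 := by linarith
    have : y ≤ a.2 := by exact_mod_cast this
    show 1 < a.2
    omega
  · obtain ⟨a, ha, hle⟩ := hr 0 (-1)
    refine ⟨a, ha, ?_⟩
    have : (a.2 : ℝ) ≤ 0 := by linarith
    have : a.2 ≤ 0 := by exact_mod_cast this
    show a.2 < 1
    omega

theorem planeSurrounded_or_row_of_nonneg {A : Finset (ℤ × ℤ)} (hA : 7 ≤ A.card)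
    (hl : PlaneDominated A (-1) 0) (hr : PlaneDominated A 1 0) (hpos : ∀ a ∈ A, 0 ≤ a.2) :
    (∃ p, PlaneSurrounded A p) ∨ ∃ c, 4 ≤ (A.filter fun a => a.2 = c).card := by
  classical
  by_contra hno
  push Not at hno
  obtain ⟨hns, hrow⟩ := hno
  have hle2 : ∀ a ∈ A, a.2 ≤ 2 := by
    intro a ha
    by_contra hgt
    have hy : 0 < a.2 := by omega
    refine hns _ (planeSurrounded_of_triangle hl hr (m := (a.1 + 1) / a.2) (by omega)
      (planeDominated_of_mem ha) ?_ ?_)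
    · have := Int.lt_ediv_add_one_mul_self (a.1 + 1) hy
      linarith
    · have := Int.ediv_mul_le (a.1 + 1) hy.ne'
      linarith
  have heven : ∀ x : ℤ, Even x → ¬ PlaneDominated A x 2 := by
    rintro x ⟨m, rfl⟩ hdom
    exact hns _ (planeSurrounded_of_triangle hl hr (m := m) (x := m + m) (y := 2) le_rfl
      (by exact_mod_cast hdom) (by omega) (by omega))
  have hodd : ∀ a ∈ A, a.2 = 2 → Odd a.1 := by
    intro a ha h2
    rw [← Int.not_even_iff_odd]
    intro he
    refine heven _ he ?_
    have := planeDominated_of_mem ha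
    rw [h2] at this
    exact_mod_cast this
  have hsep : ∀ a ∈ A, ∀ b ∈ A, a.2 = 2 → b.2 = 2 → ¬ a.1 < b.1 := by
    intro a ha b hb ha2 hb2 hlt
    have hoa := hodd a ha ha2
    have hob := hodd b hb hb2
    have hab : a.1 + 1 < b.1 := by
      obtain ⟨s, hs⟩ := hoa
      obtain ⟨t, ht⟩ := hob
      omega
    refine heven (a.1 + 1) hoa.add_one ?_
    have hda := planeDominated_of_mem ha
    have hdb := planeDominated_of_mem hb
    rw [ha2] at hda
    rw [hb2] at hdb
    have hab' : (a.1 : ℝ) + 1 < b.1 := by exact_mod_cast hab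
    have hpos' : (0 : ℝ) < b.1 - a.1 := by linarith
    have := hda.combo hdb (t := 1 / (b.1 - a.1)) (by positivity)
      (by rw [div_le_one hpos']; linarith)
    convert this using 1
    · push_cast
      field_simp
      ring
    · push_cast
      ring
  have hsub : A ⊆ (A.filter fun a => a.2 = 0) ∪ (A.filter fun a => a.2 = 1) ∪
      (A.filter fun a => a.2 = 2) := by
    intro a ha
    have h0 := hpos a ha
    have h2 := hle2 a ha
    simp only [Finset.mem_union, Finset.mem_filter, ha, true_and]
    omega
  have hcard := Finset.card_le_card hsub
  have hu1 := Finset.card_union_le ((A.filter fun a => a.2 = 0) ∪ (A.filter fun a => a.2 = 1))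
    (A.filter fun a => a.2 = 2)
  have hu2 := Finset.card_union_le (A.filter fun a => a.2 = 0) (A.filter fun a => a.2 = 1)
  have hc0 := hrow 0
  have hc1 := hrow 1
  have hc2 : (A.filter fun a => a.2 = 2).card ≤ 1 := by
    rw [Finset.card_le_one]
    intro a ha b hb
    rw [Finset.mem_filter] at ha hb
    have h1 := hsep a ha.1 b hb.1 ha.2 hb.2
    have h2 := hsep b hb.1 a ha.1 hb.2 ha.2
    exact Prod.ext (by omega) (ha.2.trans hb.2.symm)
  have hn2 : (A.filter fun a => a.2 = 2).Nonempty := by rw [← Finset.card_pos]; omega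
  have hn0 : (A.filter fun a => a.2 = 0).Nonempty := by rw [← Finset.card_pos]; omega
  obtain ⟨a, ha⟩ := hn2
  obtain ⟨b, hb⟩ := hn0
  rw [Finset.mem_filter] at ha hb
  obtain ⟨p, hp⟩ := planeSurrounded_of_row (c := 1) (A := A) (by omega)
    ⟨a, ha.1, by omega⟩ ⟨b, hb.1, by omega⟩
  exact hns p hp

/-- Seven lattice points in the plane surround a lattice point, or four of them lie on a row that
bounds the set on one side. -/
theorem planeSurrounded_or_row {A : Finset (ℤ × ℤ)} (hA : 7 ≤ A.card)
    (hl : PlaneDominated A (-1) 0) (hr : PlaneDominated A 1 0) :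
    (∃ p, PlaneSurrounded A p) ∨ ∃ c s : ℤ, (s = 1 ∨ s = -1) ∧
      4 ≤ (A.filter fun a => a.2 = c).card ∧ ∀ a ∈ A, 0 ≤ s * (a.2 - c) := by
  classical
  have hrow : (∃ p, PlaneSurrounded A p) ∨ ∃ c, 4 ≤ (A.filter fun a => a.2 = c).card := by
    by_cases hpos : ∀ a ∈ A, 0 ≤ a.2
    · exact planeSurrounded_or_row_of_nonneg hA hl hr hpos
    by_cases hneg : ∀ a ∈ A, a.2 ≤ 0
    · set f : ℤ × ℤ → ℤ × ℤ := fun a => (a.1, -a.2) with hf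
      have hfi : Function.Injective f := by
        rintro ⟨a, b⟩ ⟨c, e⟩ h
        simpa [hf] using h
      have hdom : ∀ x, PlaneDominated A x 0 → PlaneDominated (A.image f) x 0 := by
        intro x hx α β
        obtain ⟨a, ha, hle⟩ := hx α (-β)
        refine ⟨f a, Finset.mem_image_of_mem f ha, ?_⟩
        simp only [hf]
        push_cast
        linarith
      rcases planeSurrounded_or_row_of_nonneg (A := A.image f)
        (by rwa [Finset.card_image_of_injective _ hfi]) (hdom _ hl) (hdom _ hr) (by
          intro a ha
          obtain ⟨b, hb, rfl⟩ := Finset.mem_image.1 ha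
          have := hneg b hb
          show 0 ≤ -b.2
          omega) with ⟨p, hp⟩ | ⟨c, hc⟩
      · left
        refine ⟨f p, fun α β hαβ => ?_⟩
        obtain ⟨a, ha, h0⟩ := hp α (-β) (by simpa using hαβ)
        obtain ⟨b, hb, rfl⟩ := Finset.mem_image.1 ha
        refine ⟨b, hb, ?_⟩
        simp only [hf] at h0 ⊢
        push_cast at h0 ⊢
        linarith
      · right
        refine ⟨-c, hc.trans ?_⟩
        rw [Finset.filter_image, Finset.card_image_of_injective _ hfi]
        apply Finset.card_le_card
        intro a ha
        rw [Finset.mem_filter] at ha ⊢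
        have h2 : -a.2 = c := ha.2
        exact ⟨ha.1, by omega⟩
    · push Not at hpos hneg
      left
      refine ⟨(0, 0), planeSurrounded_of_cross (l := -1) (r := 1) (by simpa using hl)
        (by simpa using hr) (by simp) (by simp) ?_ ?_⟩
      · obtain ⟨a, ha, h⟩ := hneg
        exact ⟨a, ha, h⟩
      · obtain ⟨a, ha, h⟩ := hpos
        exact ⟨a, ha, h⟩
  rcases hrow with h | ⟨c, hc⟩
  · exact Or.inl h
  by_cases habove : ∃ a ∈ A, c < a.2
  · by_cases hbelow : ∃ a ∈ A, a.2 < c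
    · exact Or.inl (planeSurrounded_of_row (by omega) habove hbelow)
    · push Not at hbelow
      exact Or.inr ⟨c, 1, Or.inl rfl, hc, fun a ha => by have := hbelow a ha; omega⟩
  · push Not at habove
    exact Or.inr ⟨c, -1, Or.inr rfl, hc, fun a ha => by have := habove a ha; omega⟩

/-- The version of `planeSurrounded_or_row` without a choice of coordinates. -/
theorem surrounded_or_line {A : Finset (Fin 2 → ℤ)} (hA : 7 ≤ A.card) :
    (∃ p : Fin 2 → ℤ, ∀ w : Fin 2 → ℝ, w ≠ 0 → ∃ a ∈ A, 0 < ∑ l, w l * ((a l : ℝ) - p l)) ∨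
    ∃ c v : Fin 2 → ℤ, IsCoprime (v 0) (v 1) ∧
      4 ≤ (A.filter fun x => v 0 * (x 1 - c 1) - v 1 * (x 0 - c 0) = 0).card ∧
      ∀ x ∈ A, 0 ≤ v 0 * (x 1 - c 1) - v 1 * (x 0 - c 0) := by
  classical
  obtain ⟨A', hA'A, hcard, -, hA', -⟩ := exists_large_residue_class (m := 1) (N := 2) one_pos
    two_pos (A := A) fun x _ y _ => LatticeCong.one x y
  obtain ⟨a, ha, b, hb, hab⟩ := Finset.one_lt_card.1 (show 1 < A'.card by omega)
  have hcong := hA' a ha b hb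
  rw [one_mul] at hcong
  set g : ℤ := (Int.gcd (b 0 - a 0) (b 1 - a 1) : ℤ) with hg
  have hg0 : 0 < g := by
    rw [hg]
    have : Int.gcd (b 0 - a 0) (b 1 - a 1) ≠ 0 := by
      intro h
      rw [Int.gcd_eq_zero_iff] at h
      apply hab
      funext i
      fin_cases i
      · show a 0 = b 0
        omega
      · show a 1 = b 1
        omega
    omega
  have hg2 : 2 ≤ g := by
    have h2g : (2 : ℤ) ∣ g := by
      rw [hg]
      exact Int.dvd_coe_gcd (by simpa using (hcong 0).dvd) (by simpa using (hcong 1).dvd)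
    exact Int.le_of_dvd hg0 h2g
  obtain ⟨v0, hv0⟩ : g ∣ b 0 - a 0 := Int.gcd_dvd_left _ _
  obtain ⟨v1, hv1⟩ : g ∣ b 1 - a 1 := Int.gcd_dvd_right _ _
  obtain ⟨u1, u0, huv⟩ : ∃ u1 u0 : ℤ, v0 * u1 - v1 * u0 = 1 := by
    have hbez := Int.gcd_eq_gcd_ab (b 0 - a 0) (b 1 - a 1)
    rw [← hg, hv0, hv1] at hbez
    refine ⟨Int.gcdA (g * v0) (g * v1), -Int.gcdB (g * v0) (g * v1), ?_⟩
    have : g * (v0 * Int.gcdA (g * v0) (g * v1) - v1 * -Int.gcdB (g * v0) (g * v1)) = g * 1 := by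
      linarith
    exact mul_left_cancel₀ hg0.ne' this
  set X : (Fin 2 → ℤ) → ℤ := fun x => (x 0 - (a 0 + v0)) * u1 - (x 1 - (a 1 + v1)) * u0 with hX
  set Y : (Fin 2 → ℤ) → ℤ := fun x => v0 * (x 1 - (a 1 + v1)) - v1 * (x 0 - (a 0 + v0)) with hY
  have hx0 : ∀ x : Fin 2 → ℤ, x 0 = a 0 + v0 + X x * v0 + Y x * u0 := by
    intro x
    simp only [hX, hY]
    linear_combination (-(x 0 - (a 0 + v0))) * huv
  have hx1 : ∀ x : Fin 2 → ℤ, x 1 = a 1 + v1 + X x * v1 + Y x * u1 := by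
    intro x
    simp only [hX, hY]
    linear_combination (-(x 1 - (a 1 + v1))) * huv
  set f : (Fin 2 → ℤ) → ℤ × ℤ := fun x => (X x, Y x) with hf
  have hfi : Function.Injective f := by
    intro x y h
    have h1 : X x = X y := congrArg Prod.fst h
    have h2 : Y x = Y y := congrArg Prod.snd h
    funext i
    fin_cases i
    · show x 0 = y 0
      rw [hx0 x, hx0 y, h1, h2]
    · show x 1 = y 1
      rw [hx1 x, hx1 y, h1, h2]
  have hfa : f a = (-1, 0) := by
    simp only [hf, hX, hY, Prod.mk.injEq]
    constructor
    · linear_combination -huv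
    · ring
  have hfb : f b = (g - 1, 0) := by
    simp only [hf, hX, hY, Prod.mk.injEq]
    have e0 : b 0 = a 0 + g * v0 := by linarith
    have e1 : b 1 = a 1 + g * v1 := by linarith
    rw [e0, e1]
    constructor
    · linear_combination (g - 1) * huv
    · ring
  have hda : PlaneDominated (A.image f) (-1) 0 := by
    have := planeDominated_of_mem (Finset.mem_image_of_mem f (hA'A ha))
    rw [hfa] at this
    simpa using this
  have hdb : PlaneDominated (A.image f) 1 0 := by
    have := planeDominated_of_mem (Finset.mem_image_of_mem f (hA'A hb))
    rw [hfb] at this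
    have hg2' : (2 : ℝ) ≤ g := by exact_mod_cast hg2
    have h := hda.combo this (t := 2 / g) (by positivity)
      (by rw [div_le_one (by linarith)]; exact hg2')
    convert h using 1
    · push_cast
      field_simp
      ring
    · simp
  rcases planeSurrounded_or_row (A := A.image f)
    (by rwa [Finset.card_image_of_injective _ hfi]) hda hdb with ⟨p, hp⟩ | ⟨c, s, hs, hc, hside⟩
  · left
    refine ⟨![a 0 + v0 + p.1 * v0 + p.2 * u0, a 1 + v1 + p.1 * v1 + p.2 * u1], fun w hw => ?_⟩
    have huvR : (v0 : ℝ) * u1 - v1 * u0 = 1 := by exact_mod_cast huv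
    obtain ⟨q, hq, h0⟩ := hp (w 0 * v0 + w 1 * v1) (w 0 * u0 + w 1 * u1) (by
      by_contra hno
      push Not at hno
      apply hw
      funext i
      fin_cases i
      · show w 0 = 0
        linear_combination (u1 : ℝ) * hno.1 - v1 * hno.2 - w 0 * huvR
      · show w 1 = 0
        linear_combination (-u0 : ℝ) * hno.1 + v0 * hno.2 - w 1 * huvR)
    obtain ⟨x, hx, rfl⟩ := Finset.mem_image.1 hq
    refine ⟨x, hx, ?_⟩
    have e0 : (x 0 : ℝ) = a 0 + v0 + X x * v0 + Y x * u0 := by exact_mod_cast hx0 x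
    have e1 : (x 1 : ℝ) = a 1 + v1 + X x * v1 + Y x * u1 := by exact_mod_cast hx1 x
    rw [Fin.sum_univ_two]
    simp only [Matrix.cons_val_zero, Matrix.cons_val_one]
    push_cast
    rw [e0, e1]
    simp only [hf] at h0
    linarith
  · right
    have hYc : ∀ x : Fin 2 → ℤ, s * v0 * (x 1 - (a 1 + v1 + c * u1)) -
        s * v1 * (x 0 - (a 0 + v0 + c * u0)) = s * (Y x - c) := by
      intro x
      simp only [hY]
      linear_combination (-s * c) * huv
    refine ⟨![a 0 + v0 + c * u0, a 1 + v1 + c * u1], ![s * v0, s * v1], ?_, ?_, ?_⟩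
    · refine ⟨s * u1, -(s * u0), ?_⟩
      simp only [Matrix.cons_val_zero, Matrix.cons_val_one]
      have : s * s = 1 := by rcases hs with rfl | rfl <;> norm_num
      linear_combination (v0 * u1 - v1 * u0) * this + huv
    · rw [Finset.filter_image, Finset.card_image_of_injective _ hfi] at hc
      refine hc.trans (Finset.card_le_card fun x hx => ?_)
      obtain ⟨hxA, hxc⟩ := Finset.mem_filter.1 hx
      refine Finset.mem_filter.2 ⟨hxA, ?_⟩
      have : Y x = c := hxc
      simp only [Matrix.cons_val_zero, Matrix.cons_val_one]
      rw [hYc, this, sub_self, mul_zero]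
    · intro x hx
      simp only [Matrix.cons_val_zero, Matrix.cons_val_one]
      rw [hYc]
      exact hside (f x) (Finset.mem_image_of_mem f hx)

/-- The lattice points of the line through `c` in direction `v`. -/
def linePoint (c v : Fin 2 → ℤ) (t : ℤ) : Fin 2 → ℤ := fun i => c i + t * v i

theorem linePoint_cong {c v : Fin 2 → ℤ} (hv : IsCoprime (v 0) (v 1)) {N : ℕ} {s t : ℤ} :
    LatticeCong N (linePoint c v s) (linePoint c v t) ↔ (N : ℤ) ∣ t - s := by
  obtain ⟨a, b, hab⟩ := hv
  have hdiff : ∀ i, linePoint c v t i - linePoint c v s i = (t - s) * v i := fun i => by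
    simp only [linePoint]; ring
  constructor
  · intro h
    have h0 := (h 0).dvd
    have h1 := (h 1).dvd
    rw [hdiff] at h0 h1
    have := (h0.mul_left a).add (h1.mul_left b)
    have e : a * ((t - s) * v 0) + b * ((t - s) * v 1) = t - s := by
      linear_combination (t - s) * hab
    rwa [e] at this
  · intro h i
    rw [Int.modEq_iff_dvd, hdiff]
    exact h.mul_right _

theorem exists_image_linePoint {c v : Fin 2 → ℤ} (hv : IsCoprime (v 0) (v 1))
    {S : Finset (Fin 2 → ℤ)} (hS : ∀ x ∈ S, v 0 * (x 1 - c 1) - v 1 * (x 0 - c 0) = 0) :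
    ∃ T : Finset ℤ, T.card = S.card ∧ ∀ t ∈ T, linePoint c v t ∈ S := by
  classical
  obtain ⟨a, b, hab⟩ := hv
  have hpt : ∀ x ∈ S, linePoint c v (a * (x 0 - c 0) + b * (x 1 - c 1)) = x := by
    intro x hx
    have h := hS x hx
    funext i
    fin_cases i
    · show c 0 + (a * (x 0 - c 0) + b * (x 1 - c 1)) * v 0 = x 0
      linear_combination b * h + (x 0 - c 0) * hab
    · show c 1 + (a * (x 0 - c 0) + b * (x 1 - c 1)) * v 1 = x 1
      linear_combination -a * h + (x 1 - c 1) * hab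
  refine ⟨S.image fun x => a * (x 0 - c 0) + b * (x 1 - c 1), ?_, fun t ht => ?_⟩
  · apply Finset.card_image_of_injOn
    intro x hx y hy hxy
    dsimp only at hxy
    rw [← hpt x hx, ← hpt y hy, hxy]
  · obtain ⟨x, hx, rfl⟩ := Finset.mem_image.1 ht
    rw [hpt x hx]
    exact hx

theorem abs_sub_lt_of_linePoint_mem {c v : Fin 2 → ℤ} (hv : IsCoprime (v 0) (v 1)) {n : ℕ} {s t : ℤ}
    (hs : linePoint c v s ∈ latticeCube 2 n) (ht : linePoint c v t ∈ latticeCube 2 n) :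
    |t - s| < n ∧ ∀ i, |(t - s) * v i| < n := by
  have hdiff : ∀ i, |(t - s) * v i| < n := by
    intro i
    have h1 := mem_latticeCube.1 hs i
    have h2 := mem_latticeCube.1 ht i
    have : (t - s) * v i = linePoint c v t i - linePoint c v s i := by
      simp only [linePoint]; ring
    rw [this, abs_lt]
    constructor <;> linarith [h1.1, h1.2, h2.1, h2.2]
  refine ⟨?_, hdiff⟩
  have hne : v 0 ≠ 0 ∨ v 1 ≠ 0 := by
    by_contra hno
    push Not at hno
    rw [hno.1, hno.2] at hv
    simp [isCoprime_zero_left] at hv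
  have hcase : ∀ i, v i ≠ 0 → |t - s| < n := by
    intro i hi
    refine lt_of_le_of_lt ?_ (hdiff i)
    rw [abs_mul]
    exact le_mul_of_one_le_right (abs_nonneg _) (Int.one_le_abs hi)
  rcases hne with h | h
  · exact hcase 0 h
  · exact hcase 1 h

/-- A function on the integers that separates residue classes modulo `2 ^ (k + 1)` at scale
`θ ^ k`, for all `k < K`. -/
structure BinaryHierarchical (K : ℕ) (B θ : ℝ) (h : ℤ → ℝ) : Prop where
  abs_sub_le : ∀ k ≤ K, ∀ s t : ℤ, 2 ^ k ∣ t - s → |h s - h t| ≤ B * θ ^ k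
  le_abs_sub : ∀ k < K, ∀ s t : ℤ, 2 ^ k ∣ t - s → ¬ 2 ^ (k + 1) ∣ t - s → θ ^ k / 2 ≤ |h s - h t|

theorem Hierarchical.comp_linePoint {K : ℕ} {B θ : ℝ} {f : (Fin 2 → ℤ) → ℝ}
    (hf : Hierarchical 2 K B θ f) {c v : Fin 2 → ℤ} (hv : IsCoprime (v 0) (v 1)) :
    BinaryHierarchical K B θ fun t => f (linePoint c v t) :=
  ⟨fun k hk s t hst => hf.abs_sub_le k hk _ _ ((linePoint_cong hv).2 (by exact_mod_cast hst)),
    fun k hk s t hst hnst => hf.le_abs_sub k hk _ _ ((linePoint_cong hv).2 (by exact_mod_cast hst))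
      fun h => hnst (by exact_mod_cast (linePoint_cong hv).1 h)⟩

theorem exists_binary_split {K k₀ : ℕ} {T : Finset ℤ} (hT : 1 < T.card)
    (hK : ∀ s ∈ T, ∀ t ∈ T, |t - s| < 2 ^ K) (hk₀ : ∀ s ∈ T, ∀ t ∈ T, (2 : ℤ) ^ k₀ ∣ t - s) :
    ∃ m, k₀ ≤ m ∧ m < K ∧ (∀ s ∈ T, ∀ t ∈ T, (2 : ℤ) ^ m ∣ t - s) ∧
      ∃ a ∈ T, ∃ b ∈ T, ¬ (2 : ℤ) ^ (m + 1) ∣ b - a := by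
  classical
  have hfin : ∀ k, K ≤ k → ¬ ∀ s ∈ T, ∀ t ∈ T, (2 : ℤ) ^ k ∣ t - s := by
    intro k hk h
    obtain ⟨s, hs, t, ht, hst⟩ := Finset.one_lt_card.1 hT
    have h1 := (pow_dvd_pow (2 : ℤ) hk).trans (h s hs t ht)
    exact hst (sub_eq_zero.1 (Int.eq_zero_of_abs_lt_dvd h1 (hK s hs t ht))).symm
  have hex : ∃ k, ¬ ∀ s ∈ T, ∀ t ∈ T, (2 : ℤ) ^ (k + 1) ∣ t - s := ⟨K, hfin _ (Nat.le_succ K)⟩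
  have h1 := Nat.find_spec hex
  have h0 : k₀ ≤ Nat.find hex := by
    by_contra hlt
    exact h1 fun s hs t ht => (pow_dvd_pow 2 (by omega)).trans (hk₀ s hs t ht)
  have h2 : ∀ s ∈ T, ∀ t ∈ T, (2 : ℤ) ^ (Nat.find hex) ∣ t - s := by
    rcases Nat.eq_zero_or_pos (Nat.find hex) with hz | hpos
    · rw [hz]; simp
    · have := Nat.find_min hex (m := Nat.find hex - 1) (by omega)
      rw [not_not, Nat.sub_add_cancel hpos] at this
      exact this
  refine ⟨Nat.find hex, h0, ?_, h2, ?_⟩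
  · by_contra hge
    exact hfin _ (not_lt.1 hge) h2
  · exact by_contra fun hno => h1 fun s hs t ht => by_contra fun hd => hno ⟨s, hs, t, ht, hd⟩

theorem two_pow_succ_dvd_sub {m : ℕ} {a b t : ℤ} (hab : (2 : ℤ) ^ m ∣ b - a)
    (hnab : ¬ (2 : ℤ) ^ (m + 1) ∣ b - a) (ht : (2 : ℤ) ^ m ∣ t - a)
    (hnt : ¬ (2 : ℤ) ^ (m + 1) ∣ t - a) : (2 : ℤ) ^ (m + 1) ∣ t - b := by
  obtain ⟨u, hu⟩ := hab
  obtain ⟨w, hw⟩ := ht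
  have hm : (2 : ℤ) ^ m ≠ 0 := by positivity
  rw [hu, pow_succ, mul_dvd_mul_iff_left hm] at hnab
  rw [hw, pow_succ, mul_dvd_mul_iff_left hm] at hnt
  have : t - b = 2 ^ m * (w - u) := by linarith
  rw [this, pow_succ, mul_dvd_mul_iff_left hm]
  omega

/-- The gap between the two residue classes at a splitting level. -/
theorem BinaryHierarchical.gap {K m : ℕ} {B θ σ : ℝ} {h : ℤ → ℝ} (hh : BinaryHierarchical K B θ h)
    (hm : m < K) (hθ : 0 < θ) (hBθ : 8 * (B * θ) ≤ 1) (hσ : σ = 1 ∨ σ = -1) {a b s t : ℤ}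
    (hab : (2 : ℤ) ^ m ∣ b - a) (hnab : ¬ (2 : ℤ) ^ (m + 1) ∣ b - a) (hσab : 0 ≤ σ * (h b - h a))
    (hs : (2 : ℤ) ^ (m + 1) ∣ s - a) (ht : (2 : ℤ) ^ (m + 1) ∣ t - b) :
    θ ^ m / 4 ≤ σ * (h t - h s) := by
  have h1 := hh.le_abs_sub m hm a b hab hnab
  have h2 := hh.abs_sub_le (m + 1) hm a s hs
  have h3 := hh.abs_sub_le (m + 1) hm b t ht
  have h4 : θ ^ m / 2 ≤ σ * (h b - h a) := by
    rw [abs_sub_comm] at h1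
    rcases hσ with rfl | rfl
    · rwa [abs_of_nonneg (by linarith), ← one_mul (h b - h a)] at h1
    · rw [abs_of_nonpos (by linarith)] at h1
      linarith
  have h5 : B * θ ^ (m + 1) ≤ θ ^ m / 8 := by
    have : 0 < θ ^ m := by positivity
    rw [pow_succ]
    nlinarith
  rw [abs_le] at h2 h3
  rcases hσ with rfl | rfl <;> linarith [h2.1, h2.2, h3.1, h3.2]

/-- Among four points of a line, two enclose a lattice point on the prescribed side of their
chord. -/
theorem BinaryHierarchical.exists_beyond_chord {K D k₀ : ℕ} {B θ σ : ℝ} {h : ℤ → ℝ}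
    (hh : BinaryHierarchical K B θ h) (hB : 0 < B) (hθ : 0 < θ) (hBθ : 8 * ((D + 1) * (B * θ)) ≤ 1)
    (hσ : σ = 1 ∨ σ = -1) (hDK : D ≤ 2 ^ K) {T : Finset ℤ} (hT : 4 ≤ T.card)
    (hD : ∀ s ∈ T, ∀ t ∈ T, |t - s| < D) (hk₀ : ∀ s ∈ T, ∀ t ∈ T, (2 : ℤ) ^ k₀ ∣ t - s) :
    ∃ q ∈ T, ∃ r ∈ T, ∃ p, q < p ∧ p < r ∧ (2 : ℤ) ^ k₀ ∣ p - q ∧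
      0 < σ * ((r - p) * (h p - h q) + (p - q) * (h p - h r)) := by
  classical
  have hDK' : (D : ℤ) ≤ 2 ^ K := by exact_mod_cast hDK
  obtain ⟨m, hk₀m, hmK, hTm, a₀, ha₀, b₀, hb₀, hab₀⟩ := exists_binary_split (K := K) (by omega)
    (fun s hs t ht => (hD s hs t ht).trans_le hDK') hk₀
  have hBθ0 : 0 < B * θ := by positivity
  have hBθ1 : 8 * (B * θ) ≤ 1 := by nlinarith [(Nat.cast_nonneg D : (0 : ℝ) ≤ D)]
  have hm0 : 0 < θ ^ m := by positivity
  obtain ⟨a, ha, b, hb, hab, hσab⟩ : ∃ a ∈ T, ∃ b ∈ T, ¬ (2 : ℤ) ^ (m + 1) ∣ b - a ∧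
      0 ≤ σ * (h b - h a) := by
    rcases le_total 0 (σ * (h b₀ - h a₀)) with h0 | h0
    · exact ⟨a₀, ha₀, b₀, hb₀, hab₀, h0⟩
    · exact ⟨b₀, hb₀, a₀, ha₀, fun h1 => hab₀ (by rw [← neg_sub]; exact h1.neg_right), by linarith⟩
  have hgap : ∀ s t : ℤ, (2 : ℤ) ^ (m + 1) ∣ s - a → (2 : ℤ) ^ (m + 1) ∣ t - b →
      θ ^ m / 4 ≤ σ * (h t - h s) := fun s t hs ht =>
    hh.gap hmK hθ hBθ1 hσ (hTm a ha b hb) hab hσab hs ht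
  have hcls : ∀ t ∈ T, ¬ (2 : ℤ) ^ (m + 1) ∣ t - a → (2 : ℤ) ^ (m + 1) ∣ t - b := fun t ht hnt =>
    two_pow_succ_dvd_sub (hTm a ha b hb) hab (hTm a ha t ht) hnt
  by_cases hlow : ∃ q ∈ T, ∃ r ∈ T, q < r ∧ (2 : ℤ) ^ (m + 1) ∣ q - a ∧ (2 : ℤ) ^ (m + 1) ∣ r - a
  · obtain ⟨q, hq, r, hr, hqr, hqa, hra⟩ := hlow
    have hqr' : (2 : ℤ) ^ (m + 1) ∣ r - q := by
      have := hra.sub hqa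
      rwa [sub_sub_sub_cancel_right] at this
    have hle := Int.le_of_dvd (by omega) hqr'
    have h2m : (0 : ℤ) < 2 ^ m := by positivity
    rw [pow_succ] at hle
    have hpb : (2 : ℤ) ^ (m + 1) ∣ q + 2 ^ m - b := by
      refine two_pow_succ_dvd_sub (hTm a ha b hb) hab ?_ ?_
      · have : q + 2 ^ m - a = (q - a) + 2 ^ m := by ring
        rw [this]
        exact dvd_add (hTm a ha q hq) dvd_rfl
      · intro hdvd
        have : q + 2 ^ m - a - (q - a) = 2 ^ m := by ring
        have h1 := Int.le_of_dvd h2m (this ▸ hdvd.sub hqa)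
        rw [pow_succ] at h1
        omega
    refine ⟨q, hq, r, hr, q + 2 ^ m, by omega, by omega, ?_, ?_⟩
    · rw [add_sub_cancel_left]
      exact pow_dvd_pow 2 hk₀m
    · have h1 := hgap q _ hqa hpb
      have h2 := hgap r _ hra hpb
      have h3 : (0 : ℝ) < (r : ℝ) - ((q + 2 ^ m : ℤ) : ℝ) := by
        have : q + 2 ^ m < r := by omega
        rw [sub_pos]
        exact_mod_cast this
      have h4 : (0 : ℝ) < ((q + 2 ^ m : ℤ) : ℝ) - q := by
        have : q < q + 2 ^ m := by omega
        rw [sub_pos]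
        exact_mod_cast this
      have h5 := mul_pos h3 (lt_of_lt_of_le (by positivity) h1)
      have h6 := mul_pos h4 (lt_of_lt_of_le (by positivity) h2)
      linarith
  · push Not at hlow
    have honly : ∀ t ∈ T, t ≠ a → (2 : ℤ) ^ (m + 1) ∣ t - b := by
      intro t ht hta
      apply hcls t ht
      intro hdvd
      rcases lt_or_gt_of_ne hta with hlt | hlt
      · exact hlow t ht a ha hlt hdvd (by simp)
      · exact hlow a ha t ht hlt (by simp) hdvd
    have hcard : 3 ≤ (T.erase a).card := by rw [Finset.card_erase_of_mem ha]; omega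
    have hne : (T.erase a).Nonempty := by rw [← Finset.card_pos]; omega
    set u₁ := (T.erase a).min' hne with hu₁
    set u₃ := (T.erase a).max' hne with hu₃
    have hu₁m := (T.erase a).min'_mem hne
    have hu₃m := (T.erase a).max'_mem hne
    have hcard' : 0 < (((T.erase a).erase u₁).erase u₃).card := by
      have e1 := Finset.pred_card_le_card_erase (s := T.erase a) (a := u₁)
      have e2 := Finset.pred_card_le_card_erase (s := (T.erase a).erase u₁) (a := u₃)
      omega
    obtain ⟨p, hp⟩ := Finset.card_pos.1 hcard'
    rw [Finset.mem_erase, Finset.mem_erase] at hp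
    obtain ⟨hp3, hp1, hpm⟩ := hp
    have hlt1 : u₁ < p := lt_of_le_of_ne ((T.erase a).min'_le p hpm) (Ne.symm hp1)
    have hlt3 : p < u₃ := lt_of_le_of_ne ((T.erase a).le_max' p hpm) hp3
    rw [← hu₁, Finset.mem_erase] at hu₁m
    rw [← hu₃, Finset.mem_erase] at hu₃m
    rw [Finset.mem_erase] at hpm
    have hpb := honly p hpm.2 hpm.1
    have hga := hgap a p (by simp) hpb
    have hup : ∀ u ∈ T, u ≠ a → |σ * (h p - h u)| ≤ B * θ * θ ^ m := by
      intro u hu hua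
      have hub := honly u hu hua
      have h1 := hh.abs_sub_le (m + 1) hmK p u (by
        have := hub.sub hpb
        rwa [sub_sub_sub_cancel_right] at this)
      have : |σ * (h p - h u)| = |h p - h u| := by
        rw [abs_mul]
        rcases hσ with rfl | rfl <;> simp
      rw [this]
      refine h1.trans_eq ?_
      rw [pow_succ]; ring
    have key : ∀ (u : ℤ) (x y : ℝ), u ∈ T → u ≠ a → 1 ≤ x → 0 ≤ y → y ≤ D →
        0 < x * (σ * (h p - h a)) + y * (σ * (h p - h u)) := by
      intro u x y hu hua hx hy0 hyD
      have h1 := (abs_le.1 (hup u hu hua)).1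
      have h2 : θ ^ m / 4 ≤ x * (σ * (h p - h a)) := by nlinarith
      have h3 : -(D * (B * θ * θ ^ m)) ≤ y * (σ * (h p - h u)) := by
        have : 0 < B * θ * θ ^ m := by positivity
        nlinarith
      have h4 : D * (B * θ * θ ^ m) ≤ θ ^ m / 8 := by
        have : 0 < B * θ * θ ^ m := by positivity
        nlinarith
      linarith
    have hdist : ∀ s ∈ T, ∀ t ∈ T, s < t → (1 : ℝ) ≤ (t : ℝ) - s ∧ (t : ℝ) - s ≤ D := by
      intro s hs t ht hst
      have h1 : s + 1 ≤ t := hst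
      have h2 : t - s ≤ D := (le_abs_self _).trans (hD s hs t ht).le
      constructor
      · have : (s : ℝ) + 1 ≤ t := by exact_mod_cast h1
        linarith
      · exact_mod_cast h2
    rcases lt_or_gt_of_ne hpm.1 with hpa | hpa
    · refine ⟨u₁, hu₁m.2, a, ha, p, hlt1, hpa, hk₀ _ hu₁m.2 _ hpm.2, ?_⟩
      have e1 := hdist p hpm.2 a ha hpa
      have e2 := hdist u₁ hu₁m.2 p hpm.2 hlt1
      have := key u₁ ((p : ℝ) - u₁) ((a : ℝ) - p) hu₁m.2 hu₁m.1 e2.1 (by linarith) e1.2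
      linarith
    · refine ⟨a, ha, u₃, hu₃m.2, p, hpa, hlt3, hk₀ _ ha _ hpm.2, ?_⟩
      have e1 := hdist a ha p hpm.2 hpa
      have e2 := hdist p hpm.2 u₃ hu₃m.2 hlt3
      have := key u₃ ((u₃ : ℝ) - p) ((p : ℝ) - a) hu₃m.2 hu₃m.1 e2.1 (by linarith) e1.2
      linarith

/-- Surroundedness of a point is stable under small perturbations. -/
theorem exists_stable_surrounded {d : ℕ} (hd : 0 < d) {A : Finset (Fin d → ℤ)} {p : Fin d → ℤ}
    (h : ∀ w : Fin d → ℝ, w ≠ 0 → ∃ a ∈ A, 0 < ∑ l, w l * ((a l : ℝ) - p l)) :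
    ∃ ε : ℝ, 0 < ε ∧ ∀ Φ : (Fin d → ℤ) → Fin d → ℝ, (∀ x i, |Φ x i - x i| ≤ ε) →
      ∀ w : Fin d → ℝ, w ≠ 0 → ∃ a ∈ A, 0 < ∑ l, w l * (Φ a l - Φ p l) := by
  classical
  have hd' : (1 : ℝ) ≤ d := by exact_mod_cast hd
  have : Nontrivial (Fin d → ℝ) := by
    have : Nonempty (Fin d) := ⟨⟨0, hd⟩⟩
    infer_instance
  obtain ⟨w₀, hw₀⟩ := exists_ne (0 : Fin d → ℝ)
  obtain ⟨a₀, ha₀, -⟩ := h w₀ hw₀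
  have hA : A.Nonempty := ⟨a₀, ha₀⟩
  have hcont : Continuous fun w : Fin d → ℝ => A.sup' hA fun a => ∑ l, w l * ((a l : ℝ) - p l) := by
    apply Continuous.finset_sup'_apply
    intro a _
    fun_prop
  obtain ⟨w₁, hw₁, hmin⟩ := (isCompact_sphere (0 : Fin d → ℝ) 1).exists_isMinOn
    (NormedSpace.sphere_nonempty.2 zero_le_one) hcont.continuousOn
  set c := A.sup' hA fun a => ∑ l, w₁ l * ((a l : ℝ) - p l) with hc
  have hc0 : 0 < c := by
    obtain ⟨a, ha, hlt⟩ := h w₁ (by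
      rintro rfl
      simp at hw₁)
    exact hlt.trans_le (Finset.le_sup' (fun a => ∑ l, w₁ l * ((a l : ℝ) - p l)) ha)
  refine ⟨c / (4 * d), by positivity, fun Φ hΦ w hw => ?_⟩
  have hw0 : 0 < ‖w‖ := norm_pos_iff.2 hw
  set w' := ‖w‖⁻¹ • w with hw'
  have hnorm : ‖w'‖ = 1 := by
    rw [hw', norm_smul, norm_inv, norm_norm, inv_mul_cancel₀ hw0.ne']
  have hmem : w' ∈ Metric.sphere (0 : Fin d → ℝ) 1 := by simp [hnorm]
  have hle : c ≤ A.sup' hA fun a => ∑ l, w' l * ((a l : ℝ) - p l) := hmin hmem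
  obtain ⟨a, ha, hmax⟩ := Finset.exists_mem_eq_sup' hA fun a => ∑ l, w' l * ((a l : ℝ) - p l)
  rw [hmax] at hle
  have hcoord : ∀ l, |w' l| ≤ 1 := fun l => by
    rw [← hnorm, ← Real.norm_eq_abs]
    exact norm_le_pi_norm w' l
  have hpert : |∑ l, w' l * ((Φ a l - a l) - (Φ p l - p l))| ≤ c / 2 := by
    calc |∑ l, w' l * ((Φ a l - a l) - (Φ p l - p l))|
        ≤ ∑ l, |w' l * ((Φ a l - a l) - (Φ p l - p l))| := Finset.abs_sum_le_sum_abs _ _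
      _ ≤ ∑ _l : Fin d, 1 * (c / (4 * d) + c / (4 * d)) := by
          refine Finset.sum_le_sum fun l _ => ?_
          rw [abs_mul]
          exact mul_le_mul (hcoord l) ((abs_sub _ _).trans (add_le_add (hΦ a l) (hΦ p l)))
            (abs_nonneg _) zero_le_one
      _ = c / 2 := by
          rw [Finset.sum_const, Finset.card_univ, Fintype.card_fin, nsmul_eq_mul]
          field_simp
          norm_num
  have hsplit : ∑ l, w' l * (Φ a l - Φ p l) = ∑ l, w' l * ((a l : ℝ) - p l) +
      ∑ l, w' l * ((Φ a l - a l) - (Φ p l - p l)) := by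
    rw [← Finset.sum_add_distrib]
    exact Finset.sum_congr rfl fun l _ => by ring
  have hscale : ∑ l, w' l * (Φ a l - Φ p l) = ‖w‖⁻¹ * ∑ l, w l * (Φ a l - Φ p l) := by
    rw [Finset.mul_sum]
    refine Finset.sum_congr rfl fun l _ => ?_
    simp only [hw', Pi.smul_apply, smul_eq_mul]
    ring
  refine ⟨a, ha, ?_⟩
  have hpos : 0 < ‖w‖⁻¹ * ∑ l, w l * (Φ a l - Φ p l) := by
    rw [← hscale, hsplit]
    have := (abs_le.1 hpert).1
    linarith
  exact pos_of_mul_pos_right hpos (inv_nonneg.2 hw0.le)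

open Filter Topology in
theorem exists_uniform_stable_surrounded {d : ℕ} (hd : 0 < d) (n : ℕ) :
    ∃ ε : ℝ, 0 < ε ∧ ∀ A ⊆ latticeCube d n, ∀ p ∈ latticeCube d n,
      (∀ w : Fin d → ℝ, w ≠ 0 → ∃ a ∈ A, 0 < ∑ l, w l * ((a l : ℝ) - p l)) →
      ∀ Φ : (Fin d → ℤ) → Fin d → ℝ, (∀ x i, |Φ x i - x i| ≤ ε) →
      ∀ w : Fin d → ℝ, w ≠ 0 → ∃ a ∈ A, 0 < ∑ l, w l * (Φ a l - Φ p l) := by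
  have h1 : ∀ᶠ ε in 𝓝[>] (0 : ℝ), ∀ A ∈ (latticeCube d n).powerset, ∀ p ∈ latticeCube d n,
      (∀ w : Fin d → ℝ, w ≠ 0 → ∃ a ∈ A, 0 < ∑ l, w l * ((a l : ℝ) - p l)) →
      ∀ Φ : (Fin d → ℤ) → Fin d → ℝ, (∀ x i, |Φ x i - x i| ≤ ε) →
      ∀ w : Fin d → ℝ, w ≠ 0 → ∃ a ∈ A, 0 < ∑ l, w l * (Φ a l - Φ p l) := by
    rw [Filter.eventually_all_finset]
    intro A _
    rw [Filter.eventually_all_finset]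
    intro p _
    by_cases h : ∀ w : Fin d → ℝ, w ≠ 0 → ∃ a ∈ A, 0 < ∑ l, w l * ((a l : ℝ) - p l)
    · obtain ⟨ε, hε, hε'⟩ := exists_stable_surrounded hd h
      filter_upwards [nhdsWithin_le_nhds (Iio_mem_nhds hε)] with δ hδ _ Φ hΦ
      exact hε' Φ fun x i => (hΦ x i).trans (le_of_lt hδ)
    · exact Eventually.of_forall fun _ h' => absurd h' h
  obtain ⟨ε, h2, h3⟩ := (h1.and self_mem_nhdsWithin).exists
  exact ⟨ε, h3, fun A hA => h2 A (Finset.mem_powerset.2 hA)⟩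

theorem mem_latticeCube_of_surrounded {d n : ℕ} {A : Finset (Fin d → ℤ)} (hA : A ⊆ latticeCube d n)
    {p : Fin d → ℤ}
    (h : ∀ w : Fin d → ℝ, w ≠ 0 → ∃ a ∈ A, 0 < ∑ l, w l * ((a l : ℝ) - p l)) :
    p ∈ latticeCube d n := by
  classical
  rw [mem_latticeCube]
  intro i
  have key : ∀ c : ℝ, c ≠ 0 → ∃ a ∈ A, 0 < c * ((a i : ℝ) - p i) := by
    intro c hc
    obtain ⟨a, ha, h0⟩ := h (Pi.single i c) (by simpa using hc)
    refine ⟨a, ha, ?_⟩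
    rw [Finset.sum_eq_single i] at h0
    · simpa using h0
    · intro l _ hl
      simp [Pi.single_eq_of_ne hl]
    · simp
  obtain ⟨a, ha, h1⟩ := key 1 one_ne_zero
  obtain ⟨b, hb, h2⟩ := key (-1) (by norm_num)
  have h1' : (p i : ℝ) < a i := by linarith
  have h2' : (b i : ℝ) < p i := by linarith
  have h3 : p i < a i := by exact_mod_cast h1'
  have h4 : b i < p i := by exact_mod_cast h2'
  have := mem_latticeCube.1 (hA ha) i
  have := mem_latticeCube.1 (hA hb) i
  omega

/-- Three vectors of the plane with cyclically equal orientations have the origin in the interior of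
their triangle. -/
theorem exists_pos_of_orientation {ε u0 u1 v0 v1 s0 s1 w0 w1 : ℝ} (h1 : 0 < ε * (u0 * v1 - u1 * v0))
    (h2 : 0 < ε * (v0 * s1 - v1 * s0)) (h3 : 0 < ε * (s0 * u1 - s1 * u0))
    (hw : w0 ≠ 0 ∨ w1 ≠ 0) :
    0 < w0 * u0 + w1 * u1 ∨ 0 < w0 * v0 + w1 * v1 ∨ 0 < w0 * s0 + w1 * s1 := by
  by_contra hno
  push Not at hno
  obtain ⟨hu, hv, hs⟩ := hno
  have hsum : ε * (v0 * s1 - v1 * s0) * (w0 * u0 + w1 * u1)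
      + ε * (s0 * u1 - s1 * u0) * (w0 * v0 + w1 * v1)
      + ε * (u0 * v1 - u1 * v0) * (w0 * s0 + w1 * s1) = 0 := by ring
  have e1 := mul_nonpos_of_nonneg_of_nonpos h2.le hu
  have e2 := mul_nonpos_of_nonneg_of_nonpos h3.le hv
  have e3 := mul_nonpos_of_nonneg_of_nonpos h1.le hs
  have hu0 : w0 * u0 + w1 * u1 = 0 :=
    (mul_eq_zero.1 (by linarith : ε * (v0 * s1 - v1 * s0) * (w0 * u0 + w1 * u1) = 0)).resolve_left
      h2.ne'
  have hv0 : w0 * v0 + w1 * v1 = 0 :=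
    (mul_eq_zero.1 (by linarith : ε * (s0 * u1 - s1 * u0) * (w0 * v0 + w1 * v1) = 0)).resolve_left
      h3.ne'
  have hdet : u0 * v1 - u1 * v0 ≠ 0 := right_ne_zero_of_mul h1.ne'
  rcases hw with hw | hw
  · apply hw
    have : w0 * (u0 * v1 - u1 * v0) = 0 := by linear_combination v1 * hu0 - u1 * hv0
    exact (mul_eq_zero.1 this).resolve_right hdet
  · apply hw
    have : w1 * (u0 * v1 - u1 * v0) = 0 := by linear_combination u0 * hv0 - v0 * hu0
    exact (mul_eq_zero.1 this).resolve_right hdet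

theorem mul_sqrt_two_sub_ne_zero {v : Fin 2 → ℤ} (hv : IsCoprime (v 0) (v 1)) :
    (v 0 : ℝ) * √2 - v 1 ≠ 0 := by
  intro h
  by_cases h0 : v 0 = 0
  · rw [h0] at h hv
    have h1 : v 1 = 0 := by
      have : (v 1 : ℝ) = 0 := by push_cast at h; linarith
      exact_mod_cast this
    rw [h1] at hv
    exact not_isCoprime_zero_zero hv
  · have h0' : (v 0 : ℝ) ≠ 0 := by exact_mod_cast h0
    apply irrational_sqrt_two
    refine ⟨(v 1 : ℚ) / v 0, ?_⟩
    push_cast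
    rw [div_eq_iff h0']
    linarith

/-- The planar perturbed lattice. -/
noncomputable def planarPerturbation (τ : ℝ) (f : (Fin 2 → ℤ) → ℝ) (x : Fin 2 → ℤ) : Fin 2 → ℝ :=
  ![x 0 + τ * f x, x 1 + τ * (f x * √2)]

theorem planar_pos_of_orientation {τ ε : ℝ} {f : (Fin 2 → ℤ) → ℝ} {A : Finset (Fin 2 → ℤ)}
    {p q r s : Fin 2 → ℤ} (hq : q ∈ A) (hr : r ∈ A) (hs : s ∈ A)
    (h1 : 0 < ε * (((q 0 - p 0) + τ * (f q - f p)) * ((r 1 - p 1) + τ * (f r - f p) * √2) -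
      ((q 1 - p 1) + τ * (f q - f p) * √2) * ((r 0 - p 0) + τ * (f r - f p))))
    (h2 : 0 < ε * (((r 0 - p 0) + τ * (f r - f p)) * ((s 1 - p 1) + τ * (f s - f p) * √2) -
      ((r 1 - p 1) + τ * (f r - f p) * √2) * ((s 0 - p 0) + τ * (f s - f p))))
    (h3 : 0 < ε * (((s 0 - p 0) + τ * (f s - f p)) * ((q 1 - p 1) + τ * (f q - f p) * √2) -
      ((s 1 - p 1) + τ * (f s - f p) * √2) * ((q 0 - p 0) + τ * (f q - f p))))
    {w : Fin 2 → ℝ} (hw : w ≠ 0) :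
    ∃ a ∈ A, 0 < ∑ l, w l * (planarPerturbation τ f a l - planarPerturbation τ f p l) := by
  have hval : ∀ a, ∑ l, w l * (planarPerturbation τ f a l - planarPerturbation τ f p l) =
      w 0 * ((a 0 - p 0) + τ * (f a - f p)) + w 1 * ((a 1 - p 1) + τ * (f a - f p) * √2) := by
    intro a
    rw [Fin.sum_univ_two]
    simp only [planarPerturbation, Matrix.cons_val_zero, Matrix.cons_val_one]
    ring
  have hw' : w 0 ≠ 0 ∨ w 1 ≠ 0 := by
    by_contra hno
    push Not at hno
    apply hw
    funext i
    fin_cases i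
    · exact hno.1
    · exact hno.2
  rcases exists_pos_of_orientation h1 h2 h3 hw' with h | h | h
  · exact ⟨q, hq, by rw [hval]; exact h⟩
  · exact ⟨r, hr, by rw [hval]; exact h⟩
  · exact ⟨s, hs, by rw [hval]; exact h⟩

theorem linePoint_mem_latticeCube {c v : Fin 2 → ℤ} {n : ℕ} {p q r : ℤ} (hqp : q < p) (hpr : p < r)
    (hq : linePoint c v q ∈ latticeCube 2 n) (hr : linePoint c v r ∈ latticeCube 2 n) :
    linePoint c v p ∈ latticeCube 2 n := by
  rw [mem_latticeCube] at *
  intro i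
  have h1 := hq i
  have h2 := hr i
  simp only [linePoint] at *
  rcases le_total 0 (v i) with h | h
  · have e1 := mul_le_mul_of_nonneg_right hqp.le h
    have e2 := mul_le_mul_of_nonneg_right hpr.le h
    constructor <;> linarith
  · have e1 := mul_le_mul_of_nonpos_right hqp.le h
    have e2 := mul_le_mul_of_nonpos_right hpr.le h
    constructor <;> linarith

theorem exists_sign (x : ℝ) : ∃ σ : ℝ, (σ = 1 ∨ σ = -1) ∧ 0 ≤ σ * x := by
  rcases le_total 0 x with h | h
  · exact ⟨1, Or.inl rfl, by linarith⟩
  · exact ⟨-1, Or.inr rfl, by linarith⟩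

/-- Four points on a supporting line, and a point off the line. -/
theorem exists_surrounded_of_supporting_line {n : ℕ} {B θ τ : ℝ} {f : (Fin 2 → ℤ) → ℝ}
    (hf : Hierarchical 2 n B θ f) (hB : 0 < B) (hθ : 0 < θ) (hBθ : 8 * ((n + 1) * (B * θ)) ≤ 1)
    (hτ : 0 < τ) (hτB : 24 * (B * n * τ) ≤ 1) {A : Finset (Fin 2 → ℤ)} (hA : A ⊆ latticeCube 2 n)
    {c v : Fin 2 → ℤ} (hv : IsCoprime (v 0) (v 1)) {T : Finset ℤ} (hT : 4 ≤ T.card)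
    (hTA : ∀ t ∈ T, linePoint c v t ∈ A) {s : Fin 2 → ℤ} (hs : s ∈ A)
    (hside : 0 < v 0 * (s 1 - c 1) - v 1 * (s 0 - c 0)) :
    ∃ p ∈ latticeCube 2 n, ∀ w : Fin 2 → ℝ, w ≠ 0 → ∃ a ∈ A,
      0 < ∑ l, w l * (planarPerturbation τ f a l - planarPerturbation τ f p l) := by
  have hκ := mul_sqrt_two_sub_ne_zero hv
  set κ : ℝ := (v 0 : ℝ) * √2 - v 1 with hκdef
  obtain ⟨σ, hσ, hσκ⟩ := exists_sign κ
  have hσσ : σ * σ = 1 := by rcases hσ with rfl | rfl <;> norm_num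
  have hσ0 : σ ≠ 0 := by rintro rfl; norm_num at hσσ
  have hσκ' : 0 < σ * κ := lt_of_le_of_ne hσκ (mul_ne_zero hσ0 hκ).symm
  obtain ⟨q, hq, r, hr, p, hqp, hpr, -, hδ⟩ := (hf.comp_linePoint (c := c) hv).exists_beyond_chord
    (D := n) (k₀ := 0) hB hθ hBθ hσ Nat.lt_two_pow_self.le hT
    (fun s hs t ht => (abs_sub_lt_of_linePoint_mem hv (hA (hTA s hs)) (hA (hTA t ht))).1)
    (fun s _ t _ => by simp)
  have hpn := linePoint_mem_latticeCube hqp hpr (hA (hTA q hq)) (hA (hTA r hr))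
  refine ⟨linePoint c v p, hpn, fun w hw => ?_⟩
  have hsn := hA hs
  set P := linePoint c v p with hP
  set h : ℤ → ℝ := fun t => f (linePoint c v t) with hh
  have hs2 : √2 ≤ 2 := by
    rw [Real.sqrt_le_left (by norm_num)]; norm_num
  have hs0 : 0 ≤ √2 := Real.sqrt_nonneg 2
  have hY : (1 : ℝ) ≤ v 0 * (s 1 - c 1) - v 1 * (s 0 - c 0) := by exact_mod_cast hside
  have hsP : ∀ i, |(s i : ℝ) - P i| ≤ n := by
    intro i
    have e1 := mem_latticeCube.1 hsn i
    have e2 := mem_latticeCube.1 hpn i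
    have : |s i - P i| ≤ n := by
      rw [abs_le]; constructor <;> linarith [e1.1, e1.2, e2.1, e2.2]
    exact_mod_cast this
  have hthree : ∀ x y : ℝ, |x| ≤ n → |y| ≤ n → |x * √2 - y| ≤ 3 * n := by
    intro x y hx hy
    calc |x * √2 - y| ≤ |x * √2| + |y| := abs_sub _ _
      _ ≤ n * 2 + n := by
          rw [abs_mul, abs_of_nonneg hs0]
          exact add_le_add (mul_le_mul hx hs2 hs0 (by positivity)) hy
      _ = 3 * n := by ring
  have hcross : |((s 0 : ℝ) - P 0) * √2 - (s 1 - P 1)| ≤ 3 * n := hthree _ _ (hsP 0) (hsP 1)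
  have hfd : ∀ x y, |f x - f y| ≤ 2 * B := by
    intro x y
    calc |f x - f y| ≤ |f x| + |f y| := abs_sub _ _
      _ ≤ 2 * B := by linarith [hf.abs_le x, hf.abs_le y]
  have hspan : ∀ i, |((r - q) * v i : ℤ)| < n :=
    (abs_sub_lt_of_linePoint_mem hv (hA (hTA q hq)) (hA (hTA r hr))).2
  have hgκ : ∀ g : ℤ, 0 < g → g ≤ r - q → |(g : ℝ) * κ| ≤ 3 * n := by
    intro g hg0 hg
    have e : ∀ i, |(g : ℝ) * v i| ≤ n := by
      intro i
      have h1 : |g * v i| ≤ |(r - q) * v i| := by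
        rw [abs_mul, abs_mul]
        apply mul_le_mul_of_nonneg_right _ (abs_nonneg _)
        rw [abs_of_pos hg0, abs_of_pos (by omega)]
        exact hg
      have h2 : |g * v i| ≤ n := h1.trans (hspan i).le
      exact_mod_cast h2
    have : (g : ℝ) * κ = (g * v 0) * √2 - g * v 1 := by rw [hκdef]; ring
    rw [this]
    exact hthree _ _ (e 0) (e 1)
  have herr : ∀ x y u z : ℝ, |x| ≤ 3 * n → |y| ≤ 2 * B → |u| ≤ 2 * B → |z| ≤ 3 * n →
      -(1 / 2) ≤ τ * (x * y) - τ * (u * z) := by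
    intro x y u z hx hy hu hz
    have e1 : |x * y| ≤ 3 * n * (2 * B) := by
      rw [abs_mul]; exact mul_le_mul hx hy (abs_nonneg _) (by positivity)
    have e2 : |u * z| ≤ 2 * B * (3 * n) := by
      rw [abs_mul]; exact mul_le_mul hu hz (abs_nonneg _) (by positivity)
    have e3 : τ * -(3 * n * (2 * B)) ≤ τ * (x * y) :=
      mul_le_mul_of_nonneg_left (abs_le.1 e1).1 hτ.le
    have e4 : τ * (u * z) ≤ τ * (2 * B * (3 * n)) :=
      mul_le_mul_of_nonneg_left (abs_le.1 e2).2 hτ.le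
    linarith
  have hrp : (1 : ℝ) ≤ (r : ℝ) - p := by
    have : (p : ℝ) + 1 ≤ r := by exact_mod_cast hpr
    linarith
  have hpq : (1 : ℝ) ≤ (p : ℝ) - q := by
    have : (q : ℝ) + 1 ≤ p := by exact_mod_cast hqp
    linarith
  have hP0 : (P 0 : ℝ) = c 0 + p * v 0 := by rw [hP]; simp [linePoint]
  have hP1 : (P 1 : ℝ) = c 1 + p * v 1 := by rw [hP]; simp [linePoint]
  have hL : ∀ (t : ℤ) i, ((linePoint c v t i : ℤ) : ℝ) = c i + t * v i := fun t i => by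
    simp [linePoint]
  refine planar_pos_of_orientation (ε := 1) (hTA q hq) (hTA r hr) hs ?_ ?_ ?_ hw
  · have hpos : 0 < τ * ((σ * κ) *
        (σ * ((r - p) * (h p - h q) + (p - q) * (h p - h r)))) :=
      mul_pos hτ (mul_pos hσκ' hδ)
    refine hpos.trans_eq ?_
    simp only [hL, hP0, hP1, hh, hκdef, ← hP]
    linear_combination ((τ * (v 0 * √2 - v 1) * ((r - p) * (f P - f (linePoint c v q)) +
      (p - q) * (f P - f (linePoint c v r))))) * hσσ
  · have e1 := herr _ _ _ _ (hgκ (r - p) (by omega) (by omega)) (hfd s P)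
      (hfd (linePoint c v r) P) hcross
    have e2 : (1 : ℝ) ≤ (r - p) * (v 0 * (s 1 - c 1) - v 1 * (s 0 - c 0)) := by nlinarith
    simp only [hL, hP0, hP1]
    rw [hP0, hP1] at e1
    rw [hκdef] at e1
    push_cast at e1
    linarith
  · have e1 := herr _ _ _ _ (hgκ (p - q) (by omega) (by omega)) (hfd s P)
      (hfd P (linePoint c v q)) hcross
    have e2 : (1 : ℝ) ≤ (p - q) * (v 0 * (s 1 - c 1) - v 1 * (s 0 - c 0)) := by nlinarith
    simp only [hL, hP0, hP1]
    rw [hP0, hP1] at e1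
    rw [hκdef] at e1
    push_cast at e1
    linarith

/-- Seven points on one line. -/
theorem exists_surrounded_of_line {n : ℕ} {B θ τ : ℝ} {f : (Fin 2 → ℤ) → ℝ}
    (hf : Hierarchical 2 n B θ f) (hB : 0 < B) (hθ : 0 < θ) (hBθ : 8 * ((n + 1) * (B * θ)) ≤ 1)
    (hτ : 0 < τ) {A : Finset (Fin 2 → ℤ)} (hA : A ⊆ latticeCube 2 n)
    {c v : Fin 2 → ℤ} (hv : IsCoprime (v 0) (v 1)) {T : Finset ℤ} (hT : 7 ≤ T.card)
    (hTA : ∀ t ∈ T, linePoint c v t ∈ A) :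
    ∃ p ∈ latticeCube 2 n, ∀ w : Fin 2 → ℝ, w ≠ 0 → ∃ a ∈ A,
      0 < ∑ l, w l * (planarPerturbation τ f a l - planarPerturbation τ f p l) := by
  classical
  have hκ := mul_sqrt_two_sub_ne_zero hv
  set κ : ℝ := (v 0 : ℝ) * √2 - v 1 with hκdef
  have hdist : ∀ s ∈ T, ∀ t ∈ T, |t - s| < n := fun s hs t ht =>
    (abs_sub_lt_of_linePoint_mem hv (hA (hTA s hs)) (hA (hTA t ht))).1
  have hn2 : (n : ℤ) ≤ 2 ^ n := by exact_mod_cast Nat.lt_two_pow_self.le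
  obtain ⟨m, -, hmn, hTm, a₀, ha₀, b₀, hb₀, hab₀⟩ := exists_binary_split (k₀ := 0) (K := n)
    (T := T) (by omega) (fun s hs t ht => (hdist s hs t ht).trans_le hn2) (fun s _ t _ => by simp)
  obtain ⟨a, ha, b, hb, hab, hcard⟩ : ∃ a ∈ T, ∃ b ∈ T, ¬ (2 : ℤ) ^ (m + 1) ∣ b - a ∧
      4 ≤ (T.filter fun t => (2 : ℤ) ^ (m + 1) ∣ t - a).card := by
    have hsum := Finset.card_filter_add_card_filter_not (s := T)
      (fun t => (2 : ℤ) ^ (m + 1) ∣ t - a₀)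
    by_cases h4 : 4 ≤ (T.filter fun t => (2 : ℤ) ^ (m + 1) ∣ t - a₀).card
    · exact ⟨a₀, ha₀, b₀, hb₀, hab₀, h4⟩
    · refine ⟨b₀, hb₀, a₀, ha₀, fun hd => hab₀ (by rw [← neg_sub]; exact hd.neg_right), ?_⟩
      have hsub : (T.filter fun t => ¬ (2 : ℤ) ^ (m + 1) ∣ t - a₀) ⊆
          T.filter fun t => (2 : ℤ) ^ (m + 1) ∣ t - b₀ := by
        intro t ht
        rw [Finset.mem_filter] at ht ⊢
        exact ⟨ht.1, two_pow_succ_dvd_sub (hTm _ ha₀ _ hb₀) hab₀ (hTm _ ha₀ t ht.1) ht.2⟩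
      have := Finset.card_le_card hsub
      omega
  set T' := T.filter fun t => (2 : ℤ) ^ (m + 1) ∣ t - a with hT'
  have hT'T : ∀ t ∈ T', t ∈ T := fun t ht => (Finset.mem_filter.1 ht).1
  set h : ℤ → ℝ := fun t => f (linePoint c v t) with hh
  have hbin : BinaryHierarchical n B θ h := hf.comp_linePoint hv
  obtain ⟨σ, hσ, hσab⟩ := exists_sign (h b - h a)
  have hσσ : σ * σ = 1 := by rcases hσ with rfl | rfl <;> norm_num
  obtain ⟨q, hq, r, hr, p, hqp, hpr, hpq2, hδ⟩ := hbin.exists_beyond_chord (D := n) (k₀ := m + 1)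
    hB hθ hBθ hσ Nat.lt_two_pow_self.le hcard
    (fun s hs t ht => hdist s (hT'T s hs) t (hT'T t ht))
    (fun s hs t ht => by
      have := (Finset.mem_filter.1 ht).2.sub (Finset.mem_filter.1 hs).2
      rwa [sub_sub_sub_cancel_right] at this)
  have hqT := hT'T q hq
  have hrT := hT'T r hr
  have hpn := linePoint_mem_latticeCube hqp hpr (hA (hTA q hqT)) (hA (hTA r hrT))
  have hBθ0 : 0 < B * θ := by positivity
  have hn0 : (0 : ℝ) ≤ n := by positivity
  have hm0 : 0 < θ ^ m := by positivity
  have hpa : (2 : ℤ) ^ (m + 1) ∣ p - a := by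
    have := hpq2.add (Finset.mem_filter.1 hq).2
    rwa [sub_add_sub_cancel] at this
  have hgap : θ ^ m / 4 ≤ σ * (h b - h p) :=
    hbin.gap hmn hθ (by nlinarith) hσ (hTm a ha b hb) hab hσab hpa (by simp)
  have hclose : ∀ t ∈ T', |h t - h p| ≤ B * θ * θ ^ m := by
    intro t ht
    have := hbin.abs_sub_le (m + 1) hmn t p (by
      have := hpa.sub (Finset.mem_filter.1 ht).2
      rwa [sub_sub_sub_cancel_right] at this)
    rw [pow_succ] at this
    linarith
  have hbp : |(b : ℝ) - p| ≤ n := by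
    have e1 := abs_lt.1 (hdist q hqT b hb)
    have e2 := abs_lt.1 (hdist r hrT b hb)
    have : |b - p| ≤ n := by rw [abs_le]; constructor <;> linarith [e1.1, e1.2, e2.1, e2.2]
    exact_mod_cast this
  have hsmall : n * (B * θ * θ ^ m) ≤ θ ^ m / 8 := by nlinarith
  have hside : ∀ (g : ℝ) (t : ℤ), t ∈ T' → 1 ≤ g → ∀ e : ℝ, (e = 1 ∨ e = -1) →
      0 < σ * (g * (h b - h p) + e * ((b - p) * (h t - h p))) := by
    intro g t ht hg e he
    have e1 : |σ * (e * ((b - p) * (h t - h p)))| ≤ n * (B * θ * θ ^ m) := by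
      have : |σ * (e * ((b - p) * (h t - h p)))| = |(b : ℝ) - p| * |h t - h p| := by
        rw [abs_mul, abs_mul, abs_mul]
        rcases hσ with rfl | rfl <;> rcases he with rfl | rfl <;> simp
      rw [this]
      exact mul_le_mul hbp (hclose t ht) (abs_nonneg _) hn0
    have e2 := (abs_le.1 e1).1
    have e3 : θ ^ m / 4 ≤ g * (σ * (h b - h p)) := by nlinarith
    linarith
  have hrp : (1 : ℝ) ≤ (r : ℝ) - p := by
    have : (p : ℝ) + 1 ≤ r := by exact_mod_cast hpr
    linarith
  have hpq : (1 : ℝ) ≤ (p : ℝ) - q := by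
    have : (q : ℝ) + 1 ≤ p := by exact_mod_cast hqp
    linarith
  have hL : ∀ (t : ℤ) i, ((linePoint c v t i : ℤ) : ℝ) = c i + t * v i := fun t i => by
    simp [linePoint]
  have hκ2 : 0 < τ * κ ^ 2 := by positivity
  refine ⟨linePoint c v p, hpn, fun w hw => planar_pos_of_orientation (ε := κ * σ) (hTA q hqT)
    (hTA r hrT) (hTA b hb) ?_ ?_ ?_ hw⟩
  · have hpos := mul_pos hκ2 hδ
    refine hpos.trans_eq ?_
    simp only [hL, hh, hκdef]
    ring
  · have hpos := mul_pos hκ2 (hside _ r hr hrp (-1) (Or.inr rfl))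
    refine hpos.trans_eq ?_
    simp only [hL, hh, hκdef]
    ring
  · have hpos := mul_pos hκ2 (hside _ q hq hpq 1 (Or.inl rfl))
    refine hpos.trans_eq ?_
    simp only [hL, hh, hκdef]
    ring

theorem exists_planar_perturbation_holeFree (n : ℕ) :
    ∃ Φ : (Fin 2 → ℤ) → EuclideanSpace ℝ (Fin 2),
      (∀ x i, |Φ x i - x i| ≤ 1 / 4) ∧ HoleFree 7 (Φ '' (latticeCube 2 n)) := by
  obtain ⟨B, hB1, hBex⟩ := exists_hierarchical 2 n (q := 2) two_pos
  obtain ⟨ε, hε, hstab⟩ := exists_uniform_stable_surrounded two_pos n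
  have hB : 0 < B := by linarith
  have hn0 : (0 : ℝ) ≤ n := by positivity
  set θ : ℝ := 1 / (8 * ((n + 1) * B)) with hθdef
  have hθ : 0 < θ := by positivity
  have hBθ : 8 * ((n + 1) * (B * θ)) = 1 := by
    rw [hθdef]
    field_simp
  obtain ⟨f, hf⟩ := hBex θ hθ (by
    have : 0 < B * θ := by positivity
    nlinarith)
  set τ : ℝ := min (1 / (24 * (B * (n + 1)))) (ε / (2 * B)) with hτdef
  have hτ : 0 < τ := by positivity
  have hτ1 : τ * (24 * (B * (n + 1))) ≤ 1 := by
    rw [← le_div_iff₀ (by positivity)]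
    exact min_le_left _ _
  have hτ2 : τ * (2 * B) ≤ ε := by
    rw [← le_div_iff₀ (by positivity)]
    exact min_le_right _ _
  have hτ0 : 0 ≤ B * τ := by positivity
  have hτB : 24 * (B * n * τ) ≤ 1 := by nlinarith
  have hτ4 : τ * (2 * B) ≤ 1 / 4 := by nlinarith [mul_nonneg hτ0 hn0]
  have hs2 : √2 ≤ 2 := by
    rw [Real.sqrt_le_left (by norm_num)]; norm_num
  have hs0 : 0 ≤ √2 := Real.sqrt_nonneg 2
  have hnear : ∀ x i, |planarPerturbation τ f x i - x i| ≤ τ * (2 * B) := by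
    intro x i
    have h1 := hf.abs_le x
    fin_cases i
    · show |(x 0 : ℝ) + τ * f x - x 0| ≤ _
      rw [add_sub_cancel_left, abs_mul, abs_of_pos hτ]
      exact mul_le_mul_of_nonneg_left (by linarith) hτ.le
    · show |(x 1 : ℝ) + τ * (f x * √2) - x 1| ≤ _
      rw [add_sub_cancel_left, abs_mul, abs_of_pos hτ, abs_mul, abs_of_nonneg hs0, mul_comm (2 : ℝ)]
      exact mul_le_mul_of_nonneg_left (mul_le_mul h1 hs2 hs0 hB.le) hτ.le
  have hmain : ∀ A ⊆ latticeCube 2 n, A.card = 7 → ∃ p ∈ latticeCube 2 n, ∀ w : Fin 2 → ℝ, w ≠ 0 →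
      ∃ a ∈ A, 0 < ∑ l, w l * (planarPerturbation τ f a l - planarPerturbation τ f p l) := by
    intro A hA hcard
    rcases surrounded_or_line hcard.ge with ⟨p, hp⟩ | ⟨c, v, hv, h4, hside⟩
    · have hpn := mem_latticeCube_of_surrounded hA hp
      exact ⟨p, hpn, hstab A hA p hpn hp _ fun x i => (hnear x i).trans hτ2⟩
    · by_cases hoff : ∃ s ∈ A, 0 < v 0 * (s 1 - c 1) - v 1 * (s 0 - c 0)
      · obtain ⟨s, hs, hs0⟩ := hoff
        obtain ⟨T, hTc, hT⟩ := exists_image_linePoint hv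
          (S := A.filter fun x => v 0 * (x 1 - c 1) - v 1 * (x 0 - c 0) = 0)
          fun x hx => (Finset.mem_filter.1 hx).2
        exact exists_surrounded_of_supporting_line hf hB hθ hBθ.le hτ hτB hA hv (hTc ▸ h4)
          (fun t ht => (Finset.mem_filter.1 (hT t ht)).1) hs hs0
      · push Not at hoff
        obtain ⟨T, hTc, hT⟩ := exists_image_linePoint hv (S := A)
          fun x hx => le_antisymm (hoff x hx) (hside x hx)
        exact exists_surrounded_of_line hf hB hθ hBθ.le hτ hA hv (by omega) hT
  refine ⟨fun x => WithLp.toLp 2 (planarPerturbation τ f x), fun x i => (hnear x i).trans hτ4, ?_⟩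
  refine holeFree_image_latticeCube two_pos (fun x i => (hnear x i).trans hτ4) fun A hA hcard => ?_
  obtain ⟨p, hp, hpw⟩ := hmain A hA hcard
  refine ⟨p, hp, fun w hw => ?_⟩
  obtain ⟨a, ha, hpos⟩ := hpw (fun i => w i) (fun h => hw (by ext i; exact congrFun h i))
  refine ⟨a, ha, ?_⟩
  rw [PiLp.inner_apply]
  convert hpos using 2 with l
  simp [mul_comm]

/-- The exponent `O(d ^ 3)` is `A * d ^ 3` with an absolute constant `A`. -/
theorem mainTheorem3 :
    ∃ (α : ℕ → ℝ) (C : ℕ → ℕ),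
      (∃ A : ℕ, ∀ d : ℕ, 2 ≤ d → C d ≤ d ^ (A * d ^ 3)) ∧
      C 2 = 7 ∧
      ∀ d : ℕ, 2 ≤ d → ∀ k : ℕ,
        ∃ P : Finset (EuclideanSpace ℝ (Fin d)),
          P.card = k ∧
          pointSpread P ≤ α d * (k : ℝ) ^ (1 / (d : ℝ)) ∧
          HoleFree (C d) (P : Set (EuclideanSpace ℝ (Fin d))) := by
  refine ⟨fun d => 4 * d, fun d => if d = 2 then 7 else holeBound d, ⟨11, fun d hd => ?_⟩, if_pos rfl,
    fun d hd k => ?_⟩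
  · dsimp only
    split_ifs with h
    · subst h; norm_num
    · exact holeBound_le hd
  · by_cases h : d = 2
    · subst h
      simp only [if_true]
      exact exists_holeFree_of_perturbation two_pos exists_planar_perturbation_holeFree k
    · simp only [if_neg h]
      exact exists_holeFree_of_perturbation (by omega) (exists_perturbation_holeFree (by omega)) k
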